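/- **Conventions.** For real symmetric matrices, $A\preceq B$ means that $B-A$ is positive semidefinite (PSD), $A\bullet B=\mathrm{tr}(A^{\top}B)$, $A\oplus B$ is the block-diagonal matrix with blocks $A,B$, $\lambda_{\min}$ is the smallest eigenvalue, and $\mathrm{nnz}(\alpha)$ is the number of nonzero entries of $\alpha$. **One-sided oracle.** A randomised algorithm $\mathtt{Oracle}$ is a *one-sided oracle with speed $S\in(0,1]$ and error $\varepsilon>0$* if, for all PSD matrices $\mathcal M=\{M_i\}_{i=1}^m$ with $\sum_i M_i=I$, every positive definite $B\preceq I$ and all PSD matrices $C_+,C_-$, it outputs $\Delta=\sum_i\alpha_iM_i$ (given by its coefficients $\alpha$) such that always (1) $\mathrm{nnz}(\alpha)\le\lambda_{\min}(B)\,\mathrm{tr}(B^{-1})$, (2) $\Delta\preceq B$ and $\alpha_i\ge 0$ for all $i$, and, with $C=C_+-C_-$, (3) $\mathbb E[C\bullet\Delta]\ge S\lambda_{\min}(B)\,\mathrm{tr}(C)-\varepsilon S\lambda_{\min}(B)\,\mathrm{tr}(C_++C_-)$. **Algorithm $\mathtt{Sparsify}(\mathcal M,\varepsilon)$**, for PSD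 matrices $M_1,\dots,M_m\in\mathbb R^{n\times n}$ with $\sum_iM_i=I$. Start with $A=0$, $\ell=-\tfrac14$, $u=\tfrac14$. While $u-\ell<1$: put $B=(uI-A)^2\oplus(A-\ell I)^2$, $C_+=(1-2\varepsilon)(A-\ell I)^{-2}e^{(A-\ell I)^{-1}}$, $C_-=(1+2\varepsilon)(uI-A)^{-2}e^{(uI-A)^{-1}}$; call the oracle, with fresh randomness, $$\Delta\oplus\Delta=\mathtt{Oracle}\left(\{M_i\oplus M_i\}_{i=1}^m,\ B,\ \tfrac12(C_+\oplus C_+),\ \tfrac12(C_-\oplus C_-)\right);$$ then replace $A$ by $A+\varepsilon\Delta$, $u$ by $u+\varepsilon\frac{(1+2\varepsilon)(1+\varepsilon)}{1-4\varepsilon}S\lambda_{\min}(B)$ and $\ell$ by $\ell+\varepsilon\frac{(1-2\varepsilon)(1-\varepsilon)}{1+4\varepsilon}S\lambda_{\min}(B)$. When the loop ends, return $A=\sum_ic_iM_i$, where $c$ is $\varepsilon$ times the sum of the coefficient vectors returned by the oracle. **Lemma.** There are absolute constants $p,K_1,K_2,K_3>0$ such that the following holds for all $n\ge1$, all $m$,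 all PSD matrices $M_1,\dots,M_m\in\mathbb R^{n\times n}$ with $\sum_iM_i=I$, all $0<\varepsilon<1/20$, all $S\in(0,1]$ and every one-sided oracle with speed $S$ and error $\varepsilon$. With probability at least $p$, $\mathtt{Sparsify}(\mathcal M,\varepsilon)$ halts and returns $A=\sum_ic_iM_i$ such that - $A$ is, up to scaling, a $(1+O(\varepsilon))$-spectral sparsifier of $I$: $c_i\ge0$ for all $i$, and for $\kappa=K_1\varepsilon$ we have $0<\kappa<1$ and $(1-\kappa)I\preceq t\sum_ic_iM_i\preceq(1+\kappa)I$ for some $t>0$; - at most $K_2\,\frac{n}{\varepsilon^2S}$ of the coefficients $c_i$ are nonzero; - the oracle has been called at most $K_3\,\frac{\log^2\max(n,2)}{\varepsilon^2S}$ times. -/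

import Mathlib

/-- The number of nonzero entries of a finite family of reals. -/
noncomputable def nnz {ι : Type} (α : ι → ℝ) : ℕ := (Function.support α).ncard

/-- The smallest eigenvalue of a real symmetric matrix (of positive size). -/
noncomputable def lambdaMin {d : Type} [Fintype d] [DecidableEq d] (B : Matrix d d ℝ) : ℝ :=
  sInf (spectrum ℝ B)

/-- The matrix inner product `tr (Aᵀ B)`. -/
noncomputable def matInner {d : Type} [Fintype d] (A B : Matrix d d ℝ) : ℝ :=
  (A.transpose * B).trace

/-- The direct sum of two square matrices. -/
def directSum {d : Type} (A B : Matrix d d ℝ) : Matrix (d ⊕ d) (d ⊕ d) ℝ :=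
  Matrix.fromBlocks A 0 0 B

/-- The linear combination `∑ i, α i • M i`. -/
def combo {d ι : Type} [Fintype ι] (M : ι → Matrix d d ℝ) (α : ι → ℝ) : Matrix d d ℝ :=
  ∑ i, α i • M i

/-- A randomised algorithm whose input is a family of matrices `M` and matrices `B`, `C₊`, `C₋`,
and whose output is a coefficient vector `α`, standing for the matrix `∑ i, α i • M i`.
It is given by the law of its output on each input (an algorithm that halts after finitely many
coin tosses has an output law with countable support). Different calls use fresh randomness. -/
abbrev RandomisedOracle (d ι : Type) : Type :=
  (ι → Matrix d d ℝ) → Matrix d d ℝ → Matrix d d ℝ → Matrix d d ℝ → PMF (ι → ℝ)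

/-- `O` is a one-sided oracle with speed `S` and error `ε`.
The series in `expectation` is absolutely convergent because of `bounded` and `nonneg`: for
`0 ≼ Δ ≼ B` the number `|C • Δ|` is at most `(C₊ + C₋) • B`. -/
structure IsOneSidedOracle {d ι : Type} [Fintype d] [DecidableEq d] [Fintype ι]
    (O : RandomisedOracle d ι) (S ε : ℝ) : Prop where
  speed_pos : 0 < S
  speed_le_one : S ≤ 1
  error_pos : 0 < ε
  sparse : ∀ (M : ι → Matrix d d ℝ) (B Cp Cm : Matrix d d ℝ),
    (∀ i, (M i).PosSemidef) → ∑ i, M i = 1 → B.PosDef → (1 - B).PosSemidef →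
    Cp.PosSemidef → Cm.PosSemidef →
    ∀ α ∈ (O M B Cp Cm).support, (nnz α : ℝ) ≤ lambdaMin B * (B⁻¹).trace
  nonneg : ∀ (M : ι → Matrix d d ℝ) (B Cp Cm : Matrix d d ℝ),
    (∀ i, (M i).PosSemidef) → ∑ i, M i = 1 → B.PosDef → (1 - B).PosSemidef →
    Cp.PosSemidef → Cm.PosSemidef →
    ∀ α ∈ (O M B Cp Cm).support, ∀ i, 0 ≤ α i
  bounded : ∀ (M : ι → Matrix d d ℝ) (B Cp Cm : Matrix d d ℝ),
    (∀ i, (M i).PosSemidef) → ∑ i, M i = 1 → B.PosDef → (1 - B).PosSemidef →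
    Cp.PosSemidef → Cm.PosSemidef →
    ∀ α ∈ (O M B Cp Cm).support, (B - combo M α).PosSemidef
  expectation : ∀ (M : ι → Matrix d d ℝ) (B Cp Cm : Matrix d d ℝ),
    (∀ i, (M i).PosSemidef) → ∑ i, M i = 1 → B.PosDef → (1 - B).PosSemidef →
    Cp.PosSemidef → Cm.PosSemidef →
    S * lambdaMin B * (Cp - Cm).trace - ε * S * lambdaMin B * (Cp + Cm).trace ≤
      ∑' α, (O M B Cp Cm α).toReal * matInner (Cp - Cm) (combo M α)

/-- `c` is the coefficient vector of a `(1 + κ)`-spectral sparsifier of `∑ i, M i`. -/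
structure IsSpectralSparsifier {d ι : Type} [Fintype d] [DecidableEq d] [Fintype ι]
    (M : ι → Matrix d d ℝ) (κ : ℝ) (c : ι → ℝ) : Prop where
  pos : 0 < κ
  lt_one : κ < 1
  nonneg : ∀ i, 0 ≤ c i
  lower : (combo M c - (1 - κ) • ∑ i, M i).PosSemidef
  upper : ((1 + κ) • ∑ i, M i - combo M c).PosSemidef

namespace Sparsify

variable {n m : ℕ}

/-- The variables of the algorithm: the matrix `A`, the barriers `u` and `ℓ`, and, for book-keeping,
the coefficients with which the input matrices have been added up to `A`, and the number of
calls to the oracle. -/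
structure State (n m : ℕ) where
  A : Matrix (Fin n) (Fin n) ℝ
  u : ℝ
  l : ℝ
  coeff : Fin m → ℝ
  calls : ℕ

/-- `A = 0`, `u = 1/4`, `ℓ = -1/4`. -/
noncomputable def init (n m : ℕ) : State n m where
  A := 0
  u := 1 / 4
  l := -(1 / 4)
  coeff := 0
  calls := 0

/-- `u I - A`. -/
def State.upperGap (s : State n m) : Matrix (Fin n) (Fin n) ℝ := s.u • 1 - s.A

/-- `A - ℓ I`. -/
def State.lowerGap (s : State n m) : Matrix (Fin n) (Fin n) ℝ := s.A - s.l • 1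

/-- `B = (u I - A)² ⊕ (A - ℓ I)²`. -/
def State.B (s : State n m) : Matrix (Fin n ⊕ Fin n) (Fin n ⊕ Fin n) ℝ :=
  directSum (s.upperGap ^ 2) (s.lowerGap ^ 2)

/-- `C₊ = (1 - 2ε) (A - ℓ I)⁻² exp ((A - ℓ I)⁻¹)`. -/
noncomputable def State.Cplus (ε : ℝ) (s : State n m) : Matrix (Fin n) (Fin n) ℝ :=
  (1 - 2 * ε) • ((s.lowerGap⁻¹) ^ 2 * NormedSpace.exp (s.lowerGap⁻¹))

/-- `C₋ = (1 + 2ε) (u I - A)⁻² exp ((u I - A)⁻¹)`. -/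
noncomputable def State.Cminus (ε : ℝ) (s : State n m) : Matrix (Fin n) (Fin n) ℝ :=
  (1 + 2 * ε) • ((s.upperGap⁻¹) ^ 2 * NormedSpace.exp (s.upperGap⁻¹))

/-- The increase of the upper barrier in one iteration. -/
noncomputable def State.deltaU (ε S : ℝ) (s : State n m) : ℝ :=
  ε * ((1 + 2 * ε) * (1 + ε) / (1 - 4 * ε)) * S * lambdaMin s.B

/-- The increase of the lower barrier in one iteration. -/
noncomputable def State.deltaL (ε S : ℝ) (s : State n m) : ℝ :=
  ε * ((1 - 2 * ε) * (1 - ε) / (1 + 4 * ε)) * S * lambdaMin s.B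

/-- The answer of the oracle to the call made in one iteration. -/
noncomputable def State.query (O : RandomisedOracle (Fin n ⊕ Fin n) (Fin m))
    (M : Fin m → Matrix (Fin n) (Fin n) ℝ) (ε : ℝ) (s : State n m) : PMF (Fin m → ℝ) :=
  O (fun i => directSum (M i) (M i)) s.B
    ((1 / 2 : ℝ) • directSum (s.Cplus ε) (s.Cplus ε))
    ((1 / 2 : ℝ) • directSum (s.Cminus ε) (s.Cminus ε))

/-- The new state, if the oracle has answered `α`, that is `Δ = ∑ i, α i • M i`. -/
noncomputable def State.update (M : Fin m → Matrix (Fin n) (Fin n) ℝ) (ε S : ℝ) (s : State n m)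
    (α : Fin m → ℝ) : State n m where
  A := s.A + ε • combo M α
  u := s.u + s.deltaU ε S
  l := s.l + s.deltaL ε S
  coeff := s.coeff + ε • α
  calls := s.calls + 1

open Classical in
/-- One pass through the loop `while u - ℓ < 1`; a state in which the loop has stopped is kept. -/
noncomputable def step (O : RandomisedOracle (Fin n ⊕ Fin n) (Fin m))
    (M : Fin m → Matrix (Fin n) (Fin n) ℝ) (ε S : ℝ) (s : State n m) : PMF (State n m) :=
  if s.u - s.l < 1 then (s.query O M ε).map (s.update M ε S) else PMF.pure s

/-- The law of the state after at most `k` passes through the loop. -/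
noncomputable def run (O : RandomisedOracle (Fin n ⊕ Fin n) (Fin m))
    (M : Fin m → Matrix (Fin n) (Fin n) ℝ) (ε S : ℝ) : ℕ → PMF (State n m)
  | 0 => PMF.pure (init n m)
  | k + 1 => (run O M ε S k).bind (step O M ε S)

/-- The probability that the algorithm halts in a state with the property `E` (the probabilities
over which the supremum is taken are nondecreasing in `k`). -/
noncomputable def haltProb (O : RandomisedOracle (Fin n ⊕ Fin n) (Fin m))
    (M : Fin m → Matrix (Fin n) (Fin n) ℝ) (ε S : ℝ) (E : State n m → Prop) : ENNReal :=
  ⨆ k : ℕ, (run O M ε S k).toOuterMeasure {s | ¬ s.u - s.l < 1 ∧ E s}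

end Sparsify

/-! The run is governed by the barrier potential `tr exp((uI-A)⁻¹) + tr exp((A-ℓI)⁻¹)`. As a
function of a gap `W`, each summand has negative gradient `W⁻² exp(W⁻¹)`, which up to the factors `1
± 2ε` is what the oracle is queried with. Since `Δ ≼ W²` for both gaps, a step of size `ε` changes
each summand by its first-order term up to relative errors `O(ε)` (`pot_upper_step`,
`pot_lower_step`). The barrier increments are tuned so that their contribution cancels the oracle's
lower bound on the expected gain exactly. Hence the expected potential never increases
(`State.Active.mean_potential_le`).

While the potential is at most `T`, gap eigenvalues are at least `1 / log T` and `tr B⁻¹ ≤ 2T`. With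
`λ = λ_min(B)`, a call then adds at most `2Tλ` nonzero coefficients, and `1 ≤ λ log² T`. So sparsity
and number of calls are both charged to `L`, the sum of the `λ`. The barriers separate by at least
`14ε²Sλ` per call, and their distance stays at most `2`, so `L ≤ 1/(9ε²S)` (`Inv.sum_le`). On exit
the distance has grown from `1/2` to at least `1`, so it is at most twice the accumulated drift,
which is at most `7ε(u+ℓ)`. This is the sparsifier bound.

For the probability, take `T` to be twice the initial potential. The ratio potential/`T`, capped at
`1` and set to `1` when the deterministic bounds fail, is a supermartingale starting at most at
`1/2` (`mean_run_weight_le`). So after any number of passes the bounds hold with probability at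
least `1/2`. If the number of passes exceeds the bound on calls, they force the loop to have ended.

The trace estimates rest on `klein`: expanding in two eigenbases turns scalar inequalities for pairs
of eigenvalues into trace inequalities. -/

namespace Sparsify

open Matrix

/-! ### Functional calculus by explicit diagonalisation. -/

section Spectral

variable {d : Type} [Fintype d] [DecidableEq d]

/-- The symmetric matrix whose eigenvalues are `a` and whose eigenvectors are the columns of `U`. -/
noncomputable def spec (U : Matrix d d ℝ) (a : d → ℝ) : Matrix d d ℝ := U * diagonal a * Uᵀ

theorem exists_spec_eigenvalues {A : Matrix d d ℝ} (hA : A.IsHermitian) :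
    ∃ U, Uᵀ * U = 1 ∧ A = spec U hA.eigenvalues := by
  refine ⟨hA.eigenvectorUnitary, ?_, ?_⟩
  · have := (mem_unitaryGroup_iff'.1 hA.eigenvectorUnitary.2)
    rwa [star_eq_conjTranspose, conjTranspose_eq_transpose_of_trivial] at this
  · conv_lhs => rw [hA.spectral_theorem]
    rw [Unitary.conjStarAlgAut_apply, star_eq_conjTranspose, conjTranspose_eq_transpose_of_trivial]
    rfl

theorem exists_spec {A : Matrix d d ℝ} (hA : A.IsHermitian) :
    ∃ U a, Uᵀ * U = 1 ∧ A = spec U a := by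
  obtain ⟨U, hU, h⟩ := exists_spec_eigenvalues hA
  exact ⟨U, _, hU, h⟩

theorem spec_add (U : Matrix d d ℝ) (a b : d → ℝ) : spec U a + spec U b = spec U (a + b) := by
  simp only [spec, ← add_mul, ← mul_add, diagonal_add]; rfl

theorem spec_sub (U : Matrix d d ℝ) (a b : d → ℝ) : spec U a - spec U b = spec U (a - b) := by
  simp only [spec, ← sub_mul, ← mul_sub, diagonal_sub]; rfl

theorem spec_smul (U : Matrix d d ℝ) (c : ℝ) (a : d → ℝ) : c • spec U a = spec U (c • a) := by
  rw [spec, spec, diagonal_smul, Matrix.mul_smul, Matrix.smul_mul]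

theorem spec_one {U : Matrix d d ℝ} (hU : Uᵀ * U = 1) : spec U 1 = 1 := by
  rw [spec, show diagonal (1 : d → ℝ) = 1 from diagonal_one, mul_one, mul_eq_one_comm.1 hU]

theorem spec_mul {U : Matrix d d ℝ} (hU : Uᵀ * U = 1) (a b : d → ℝ) :
    spec U a * spec U b = spec U (a * b) := by
  calc spec U a * spec U b = U * diagonal a * (Uᵀ * U) * diagonal b * Uᵀ := by
        simp only [spec, mul_assoc]
    _ = spec U (a * b) := by
        rw [hU, mul_one, mul_assoc U, diagonal_mul_diagonal]; rfl

theorem spec_pow_two {U : Matrix d d ℝ} (hU : Uᵀ * U = 1) (a : d → ℝ) :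
    spec U a ^ 2 = spec U (a * a) := by
  rw [pow_two, spec_mul hU]

theorem spec_inv {U : Matrix d d ℝ} (hU : Uᵀ * U = 1) {a : d → ℝ} (ha : ∀ i, a i ≠ 0) :
    (spec U a)⁻¹ = spec U (fun i => (a i)⁻¹) := by
  apply inv_eq_right_inv
  rw [spec_mul hU, ← spec_one hU]
  congr 1
  funext i
  simp [ha i]

theorem spec_exp {U : Matrix d d ℝ} (hU : Uᵀ * U = 1) (a : d → ℝ) :
    NormedSpace.exp (spec U a) = spec U (fun i => Real.exp (a i)) := by
  have hinv : U⁻¹ = Uᵀ := inv_eq_left_inv hU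
  have hunit : IsUnit U := IsUnit.of_mul_eq_one _ (mul_eq_one_comm.1 hU)
  rw [spec, ← hinv, exp_conj _ _ hunit, exp_diagonal, spec, hinv]
  congr 3
  funext i
  rw [Pi.coe_exp, Real.exp_eq_exp_ℝ]

theorem trace_spec {U : Matrix d d ℝ} (hU : Uᵀ * U = 1) (a : d → ℝ) :
    (spec U a).trace = ∑ i, a i := by
  rw [spec, trace_mul_comm, ← mul_assoc, hU, one_mul, trace_diagonal]

theorem spec_isHermitian (U : Matrix d d ℝ) (a : d → ℝ) : (spec U a).IsHermitian := by
  rw [IsHermitian, conjTranspose_eq_transpose_of_trivial]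
  simp [spec, mul_assoc]

omit [DecidableEq d] in
theorem conj_psd {A : Matrix d d ℝ} (hA : A.PosSemidef) {R : Matrix d d ℝ} (hR : R.IsHermitian) :
    (R * A * R).PosSemidef := by
  have := hA.mul_mul_conjTranspose_same R
  rwa [hR.eq] at this

theorem spec_psd_iff {U : Matrix d d ℝ} (hU : Uᵀ * U = 1) {a : d → ℝ} :
    (spec U a).PosSemidef ↔ ∀ i, 0 ≤ a i := by
  constructor
  · intro h
    have h2 := h.conjTranspose_mul_mul_same U
    rw [conjTranspose_eq_transpose_of_trivial, spec, ← mul_assoc, ← mul_assoc, hU, one_mul,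
      mul_assoc, hU, mul_one] at h2
    exact posSemidef_diagonal_iff.1 h2
  · intro h
    have h2 := (posSemidef_diagonal_iff.2 h).mul_mul_conjTranspose_same U
    rwa [conjTranspose_eq_transpose_of_trivial] at h2

theorem spec_posDef_iff {U : Matrix d d ℝ} (hU : Uᵀ * U = 1) {a : d → ℝ} :
    (spec U a).PosDef ↔ ∀ i, 0 < a i := by
  have hunit : IsUnit U := IsUnit.of_mul_eq_one _ (mul_eq_one_comm.1 hU)
  have h := IsUnit.posDef_star_right_conjugate_iff (x := diagonal a) hunit
  rw [star_eq_conjTranspose, conjTranspose_eq_transpose_of_trivial] at h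
  rw [spec, h, posDef_diagonal_iff]

theorem exists_spec_pos {A : Matrix d d ℝ} (hA : A.PosDef) :
    ∃ U a, Uᵀ * U = 1 ∧ A = spec U a ∧ ∀ i, 0 < a i := by
  obtain ⟨U, a, hU, rfl⟩ := exists_spec hA.isHermitian
  exact ⟨U, a, hU, rfl, (spec_posDef_iff hU).1 hA⟩

theorem exists_spec_nonneg {A : Matrix d d ℝ} (hA : A.PosSemidef) :
    ∃ U a, Uᵀ * U = 1 ∧ A = spec U a ∧ ∀ i, 0 ≤ a i := by
  obtain ⟨U, a, hU, rfl⟩ := exists_spec hA.isHermitian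
  exact ⟨U, a, hU, rfl, (spec_psd_iff hU).1 hA⟩

/-- The trace of a product in terms of eigenvalues. -/
theorem trace_spec_mul_spec (U V : Matrix d d ℝ) (a b : d → ℝ) :
    (spec U a * spec V b).trace = ∑ i, ∑ j, a i * b j * ((Uᵀ * V) i j) ^ 2 := by
  have h1 : (spec U a * spec V b).trace
      = ((diagonal a * (Uᵀ * V)) * (diagonal b * (Uᵀ * V)ᵀ)).trace := by
    rw [transpose_mul, transpose_transpose, spec, spec, mul_assoc U, mul_assoc U, trace_mul_comm]
    simp only [mul_assoc]
  rw [h1, trace]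
  refine Finset.sum_congr rfl fun i _ => ?_
  rw [diag_apply, mul_apply]
  refine Finset.sum_congr rfl fun j _ => ?_
  rw [diagonal_mul, diagonal_mul, transpose_apply]
  ring

theorem trace_mul_nonneg {A B : Matrix d d ℝ} (hA : A.PosSemidef) (hB : B.PosSemidef) :
    0 ≤ (A * B).trace := by
  obtain ⟨U, a, hU, rfl, ha⟩ := exists_spec_nonneg hA
  obtain ⟨V, b, hV, rfl, hb⟩ := exists_spec_nonneg hB
  rw [trace_spec_mul_spec]
  exact Finset.sum_nonneg fun i _ => Finset.sum_nonneg fun j _ =>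
    mul_nonneg (mul_nonneg (ha i) (hb j)) (sq_nonneg _)

theorem trace_mul_le {A B C : Matrix d d ℝ} (hBC : (C - B).PosSemidef) (hA : A.PosSemidef) :
    (B * A).trace ≤ (C * A).trace := by
  have := trace_mul_nonneg hBC hA
  rw [sub_mul, trace_sub] at this
  linarith

theorem exp_psd {A : Matrix d d ℝ} (hA : A.IsHermitian) : (NormedSpace.exp A).PosSemidef := by
  obtain ⟨U, a, hU, rfl⟩ := exists_spec hA
  rw [spec_exp hU, spec_psd_iff hU]
  exact fun i => (Real.exp_pos _).le

omit [Fintype d] [DecidableEq d] in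
theorem psd_sub_trans {A B C : Matrix d d ℝ} (h₁ : (B - A).PosSemidef) (h₂ : (C - B).PosSemidef) :
    (C - A).PosSemidef := by
  have := h₂.add h₁
  rwa [sub_add_sub_cancel] at this

theorem exp_mul_comm (A : Matrix d d ℝ) : A * NormedSpace.exp A = NormedSpace.exp A * A :=
  ((Commute.refl A).exp_right).eq

end Spectral

/-! ### Klein's inequality. -/

section Klein

variable {d : Type} [Fintype d] [DecidableEq d]

local notation "𝓔" => NormedSpace.exp

/-- `B` commutes with its exponential, so cyclicity makes the two cross terms equal. Each remaining
term is the trace of a function of `A` times a function of `B`, as `trace_spec_mul_spec` requires.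
-/
theorem trace_sub_sq_mul_exp_right (A B : Matrix d d ℝ) :
    ((B - A) ^ 2 * 𝓔 B).trace
      = (1 * (B ^ 2 * 𝓔 B)).trace - 2 * (A * (B * 𝓔 B)).trace + (A ^ 2 * 𝓔 B).trace := by
  have h1 : (B * A * 𝓔 B).trace = (A * (B * 𝓔 B)).trace := by
    rw [mul_assoc, trace_mul_comm, mul_assoc, ← exp_mul_comm]
  have h2 : (B - A) ^ 2 * 𝓔 B = B ^ 2 * 𝓔 B - B * A * 𝓔 B - A * (B * 𝓔 B) + A ^ 2 * 𝓔 B := by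
    noncomm_ring
  rw [h2, trace_add, trace_sub, trace_sub, h1, one_mul]
  ring

theorem trace_sub_sq_mul_exp_left (A B : Matrix d d ℝ) :
    ((B - A) ^ 2 * 𝓔 A).trace
      = (A ^ 2 * 𝓔 A * 1).trace - 2 * ((A * 𝓔 A) * B).trace + (𝓔 A * B ^ 2).trace := by
  have := trace_sub_sq_mul_exp_right B A
  have h1 : (A - B) ^ 2 = (B - A) ^ 2 := by rw [← neg_sub B A, neg_sq]
  rw [h1] at this
  rw [this, one_mul, mul_one, trace_mul_comm B, trace_mul_comm (B ^ 2)]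

/-- Klein's inequality for polynomials times exponentials: an inequality between scalars, valid
for all pairs of eigenvalues, gives an inequality between traces. -/
theorem klein {A B : Matrix d d ℝ} (hA : A.IsHermitian) (hB : B.IsHermitian) (p q s r r' : ℝ)
    (h : ∀ x y : ℝ, 0 ≤ (p + q * (y - x) + r * (y - x) ^ 2) * Real.exp x
      + (-p + s * (y - x) + r' * (y - x) ^ 2) * Real.exp y) :
    0 ≤ p * ((𝓔 A).trace - (𝓔 B).trace) + q * ((B - A) * 𝓔 A).trace
      + s * ((B - A) * 𝓔 B).trace + r * ((B - A) ^ 2 * 𝓔 A).trace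
      + r' * ((B - A) ^ 2 * 𝓔 B).trace := by
  rw [trace_sub_sq_mul_exp_left, trace_sub_sq_mul_exp_right]
  have e1 : (𝓔 A).trace = (𝓔 A * 1).trace := by rw [mul_one]
  have e2 : (𝓔 B).trace = (1 * 𝓔 B).trace := by rw [one_mul]
  have e3 : ((B - A) * 𝓔 A).trace = (𝓔 A * B).trace - (A * 𝓔 A * 1).trace := by
    rw [sub_mul, trace_sub, trace_mul_comm B, mul_one]
  have e4 : ((B - A) * 𝓔 B).trace = (1 * (B * 𝓔 B)).trace - (A * 𝓔 B).trace := by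
    rw [sub_mul, trace_sub, one_mul]
  rw [e1, e2, e3, e4]
  obtain ⟨U, a, hU, rfl⟩ := exists_spec hA
  obtain ⟨V, b, hV, rfl⟩ := exists_spec hB
  have tU : ∀ f : d → ℝ, (spec U f * 1).trace = (spec U f * spec V 1).trace := by
    intro f; rw [spec_one hV]
  have tV : ∀ f : d → ℝ, (1 * spec V f).trace = (spec U 1 * spec V f).trace := by
    intro f; rw [spec_one hU]
  simp only [spec_exp hU, spec_exp hV, spec_pow_two hU, spec_pow_two hV, spec_mul hU, spec_mul hV,
    tU, tV]
  simp only [trace_spec_mul_spec, Finset.mul_sum, ← Finset.sum_sub_distrib,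
    ← Finset.sum_add_distrib]
  refine Finset.sum_nonneg fun i _ => Finset.sum_nonneg fun j _ => ?_
  -- Each summand is the scalar hypothesis at a pair of eigenvalues, weighted by the squared overlap
  -- of the eigenvectors.
  refine (mul_nonneg (h (a i) (b j)) (sq_nonneg ((Uᵀ * V) i j))).trans_eq ?_
  simp only [Pi.mul_apply, Pi.one_apply]
  ring

end Klein

/-! ### Perturbation of the trace exponential. -/

section ExpPerturbation

variable {d : Type} [Fintype d] [DecidableEq d]

local notation "𝓔" => NormedSpace.exp

theorem mul_exp_sub_one_le (h : ℝ) : h * (Real.exp h - 1) ≤ h ^ 2 * (1 + Real.exp h) := by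
  have h1 := Real.add_one_le_exp h
  have h2 := Real.add_one_le_exp (-h)
  have h3 : Real.exp (-h) * Real.exp h = 1 := by rw [← Real.exp_add]; simp
  have hp := Real.exp_pos h
  rcases le_total 0 h with hh | hh
  · have : (1 - h) * Real.exp h ≤ 1 := by nlinarith
    nlinarith [sq_nonneg h]
  · nlinarith [sq_nonneg h, mul_nonneg (sq_nonneg h) hp.le]

theorem exp_mul_two_sub_le {h : ℝ} (hh : 0 ≤ h) : Real.exp h * (2 - h) ≤ 2 + h := by
  let g : ℝ → ℝ := fun x => 2 + x - Real.exp x * (2 - x)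
  have hd : ∀ x, HasDerivAt g (1 - (Real.exp x * (2 - x) + Real.exp x * (-1))) x := fun x =>
    ((hasDerivAt_id x).const_add 2).sub
      ((Real.hasDerivAt_exp x).mul ((hasDerivAt_id x).const_sub 2))
  have hmono : MonotoneOn g (Set.Ici 0) := by
    apply monotoneOn_of_deriv_nonneg (convex_Ici 0)
    · exact fun x _ => (hd x).continuousAt.continuousWithinAt
    · exact fun x _ => (hd x).differentiableAt.differentiableWithinAt
    · intro x _
      rw [(hd x).deriv]
      have h2 := Real.add_one_le_exp (-x)
      have h3 : Real.exp (-x) * Real.exp x = 1 := by rw [← Real.exp_add]; simp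
      nlinarith [Real.exp_pos x]
  have := hmono (Set.mem_Ici.2 le_rfl) (Set.mem_Ici.2 hh) hh
  simp only [g, Real.exp_zero] at this
  linarith

/-- The second-order remainder is shared between the two endpoints, so the bound holds for every
real `h` and can be fed to `klein` without restricting the eigenvalues. -/
theorem exp_sub_one_sub_le (h : ℝ) :
    Real.exp h - 1 - h ≤ h ^ 2 * (1 / 2 + Real.exp h / 4) := by
  rcases le_total 0 h with hh | hh
  -- Multiply by `(2 + h) / 4`.
  · have h1 := exp_mul_two_sub_le hh
    nlinarith
  · have h1 := exp_mul_two_sub_le (neg_nonneg.2 hh)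
    have h3 : Real.exp (-h) * Real.exp h = 1 := by rw [← Real.exp_add]; simp
    have h2 : 2 + h ≤ (2 - h) * Real.exp h := by nlinarith [Real.exp_pos h]
    have h4 := Real.quadratic_le_exp_of_nonneg (neg_nonneg.2 hh)
    have h5 : (1 + -h + (-h) ^ 2 / 2) * Real.exp h ≤ 1 := by nlinarith [Real.exp_pos h]
    -- The product equals `(1 + h²/2)² - h² = 1 + h⁴/4`.
    have h6 : 1 ≤ (1 + h + h ^ 2 / 2) * (1 + -h + (-h) ^ 2 / 2) := by nlinarith [sq_nonneg (h ^ 2)]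
    have h7 : 0 < 1 + -h + (-h) ^ 2 / 2 := by nlinarith [sq_nonneg h]
    have h8 : Real.exp h ≤ 1 + h + h ^ 2 / 2 := by
      by_contra hc
      push Not at hc
      nlinarith
    nlinarith [mul_nonneg (sq_nonneg h) (Real.exp_pos h).le]

theorem trace_sub_mul_exp_mono {A B : Matrix d d ℝ} (hA : A.IsHermitian) (hB : B.IsHermitian) :
    ((B - A) * 𝓔 A).trace ≤ ((B - A) * 𝓔 B).trace := by
  have := klein hA hB 0 (-1) 1 0 0 fun x y => by
    rcases le_total x y with h | h <;> nlinarith [Real.exp_le_exp.2 h]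
  linarith

theorem trace_sub_mul_exp_le {A B : Matrix d d ℝ} (hA : A.IsHermitian) (hB : B.IsHermitian) :
    ((B - A) * 𝓔 B).trace ≤ ((B - A) * 𝓔 A).trace + ((B - A) ^ 2 * 𝓔 A).trace
      + ((B - A) ^ 2 * 𝓔 B).trace := by
  have := klein hA hB 0 1 (-1) 1 1 fun x y => by
    have h := mul_exp_sub_one_le (y - x)
    have hy : Real.exp y = Real.exp x * Real.exp (y - x) := by rw [← Real.exp_add]; ring_nf
    rw [hy]
    nlinarith [mul_le_mul_of_nonneg_left h (Real.exp_pos x).le]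
  linarith

theorem trace_exp_le_quadratic {A B : Matrix d d ℝ} (hA : A.IsHermitian) (hB : B.IsHermitian) :
    (𝓔 B).trace ≤ (𝓔 A).trace + ((B - A) * 𝓔 A).trace + 1 / 2 * ((B - A) ^ 2 * 𝓔 A).trace
      + 1 / 4 * ((B - A) ^ 2 * 𝓔 B).trace := by
  have := klein hA hB 1 1 0 (1 / 2) (1 / 4) fun x y => by
    have h := exp_sub_one_sub_le (y - x)
    have hy : Real.exp y = Real.exp x * Real.exp (y - x) := by rw [← Real.exp_add]; ring_nf
    rw [hy]
    nlinarith [mul_le_mul_of_nonneg_left h (Real.exp_pos x).le]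
  linarith

theorem trace_exp_convex {A B : Matrix d d ℝ} (hA : A.IsHermitian) (hB : B.IsHermitian) :
    (𝓔 A).trace + ((B - A) * 𝓔 A).trace ≤ (𝓔 B).trace := by
  have := klein hA hB (-1) (-1) 0 0 0 fun x y => by
    have h := Real.add_one_le_exp (y - x)
    have hy : Real.exp y = Real.exp x * Real.exp (y - x) := by rw [← Real.exp_add]; ring_nf
    rw [hy]
    nlinarith [mul_le_mul_of_nonneg_left h (Real.exp_pos x).le]
  linarith

/-- The exponential is not operator monotone, but its trace is: by convexity the increase is at
least the trace of a product of two PSD matrices. -/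
theorem trace_exp_mono {A B : Matrix d d ℝ} (hA : A.IsHermitian) (hB : B.IsHermitian)
    (hAB : (B - A).PosSemidef) : (𝓔 A).trace ≤ (𝓔 B).trace := by
  have := trace_exp_convex hA hB
  have := trace_mul_nonneg hAB (exp_psd hA)
  linarith

theorem trace_sq_mul_le {Y E : Matrix d d ℝ} {δ : ℝ} (hY : Y.PosSemidef)
    (hδ : (δ • 1 - Y).PosSemidef) (hE : E.PosSemidef) :
    (Y ^ 2 * E).trace ≤ δ * (Y * E).trace := by
  obtain ⟨U, y, hU, rfl, hy⟩ := exists_spec_nonneg hY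
  rw [← spec_one hU, spec_smul, spec_sub, spec_psd_iff hU] at hδ
  rw [show δ * (spec U y * E).trace = (δ • spec U y * E).trace by
    rw [Matrix.smul_mul, trace_smul, smul_eq_mul]]
  refine trace_mul_le ?_ hE
  rw [spec_pow_two hU, spec_smul, spec_sub, spec_psd_iff hU]
  intro i
  have h1 := hδ i
  simp only [Pi.sub_apply, Pi.smul_apply, Pi.mul_apply, Pi.one_apply, smul_eq_mul] at h1 ⊢
  nlinarith [hy i]

/-- The quadratic remainder contains `tr(Y² exp(X+Y)) ≤ δ tr(Y exp(X+Y))`. The last trace is bounded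
by itself: it is at most `(1+δ) tr(Y exp X)` plus `δ` times itself, and `δ < 1` lets it be absorbed.
-/
theorem trace_exp_add_le {X Y : Matrix d d ℝ} {δ : ℝ} (hX : X.IsHermitian) (hY : Y.PosSemidef)
    (hδ : (δ • 1 - Y).PosSemidef) (hδ0 : 0 ≤ δ) (hδ1 : δ < 1) :
    (𝓔 (X + Y)).trace
      ≤ (𝓔 X).trace + (1 + δ / 2 + δ / 4 * ((1 + δ) / (1 - δ))) * (Y * 𝓔 X).trace := by
  have hB : (X + Y).IsHermitian := hX.add hY.isHermitian
  have h1 := trace_sub_mul_exp_le hX hB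
  have h2 := trace_exp_le_quadratic hX hB
  rw [add_sub_cancel_left] at h1 h2
  have h3 := trace_sq_mul_le hY hδ (exp_psd hX)
  have h4 := trace_sq_mul_le hY hδ (exp_psd hB)
  have h5 : (Y * 𝓔 (X + Y)).trace ≤ (1 + δ) / (1 - δ) * (Y * 𝓔 X).trace := by
    rw [div_mul_eq_mul_div, le_div_iff₀ (by linarith)]
    linarith
  have h6 := mul_le_mul_of_nonneg_left h5 hδ0
  linarith

/-- Here monotonicity already gives `tr(Y exp(X-Y)) ≤ tr(Y exp X)`, so the remainders `1/2` and
`1/4` add up to `3/4` with no absorption. -/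
theorem trace_exp_sub_le {X Y : Matrix d d ℝ} {δ : ℝ} (hX : X.IsHermitian) (hY : Y.PosSemidef)
    (hδ : (δ • 1 - Y).PosSemidef) (hδ0 : 0 ≤ δ) :
    (𝓔 (X - Y)).trace ≤ (𝓔 X).trace - (1 - 3 * δ / 4) * (Y * 𝓔 X).trace := by
  have hB : (X - Y).IsHermitian := hX.sub hY.isHermitian
  have h1 := trace_sub_mul_exp_mono hX hB
  have h2 := trace_exp_le_quadratic hX hB
  rw [sub_sub_cancel_left, neg_mul, trace_neg] at h1 h2
  rw [neg_sq] at h2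
  rw [neg_mul, trace_neg] at h1
  have h3 := trace_sq_mul_le hY hδ (exp_psd hX)
  have h4 := trace_sq_mul_le hY hδ (exp_psd hB)
  have h6 := mul_le_mul_of_nonneg_left (neg_le_neg_iff.1 h1) hδ0
  linarith

end ExpPerturbation

/-! ### First-order bounds for the inverse. -/

section InversePerturbation

variable {d : Type} [Fintype d] [DecidableEq d]

/-- A positive definite matrix and its inverse in terms of a common square root. -/
theorem exists_sqrt {W : Matrix d d ℝ} (hW : W.PosDef) :
    ∃ R R' : Matrix d d ℝ, R.IsHermitian ∧ R'.IsHermitian ∧ R * R' = 1 ∧ W = R * R ∧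
      W⁻¹ = R' * R' := by
  obtain ⟨U, w, hU, rfl, hw⟩ := exists_spec_pos hW
  refine ⟨spec U fun i => √(w i), spec U fun i => (√(w i))⁻¹, spec_isHermitian _ _,
    spec_isHermitian _ _, ?_, ?_, ?_⟩
  · rw [spec_mul hU, ← spec_one hU]
    congr 1; funext i
    simp [(Real.sqrt_pos.2 (hw i)).ne']
  · rw [spec_mul hU]
    congr 1; funext i
    simp [(hw i).le]
  · rw [spec_mul hU, spec_inv hU fun i => (hw i).ne']
    congr 1; funext i
    simp only [Pi.mul_apply]
    rw [← mul_inv, Real.mul_self_sqrt (hw i).le]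

theorem conj_inv {R R' A : Matrix d d ℝ} (h : R * R' = 1) :
    (R * A * R)⁻¹ = R' * A⁻¹ * R' := by
  have h' : R⁻¹ = R' := inv_eq_right_inv h
  rw [Matrix.mul_inv_rev, Matrix.mul_inv_rev, h', mul_assoc]

/-- Conjugation by `W^(-1/2)` reduces to `W = 1`. There the claim is `1/(1-e) = 1 + e/(1-e) ≤ 1 +
e/(1-δ)` for the eigenvalues `0 ≤ e ≤ δ` of the conjugated `D`. -/
theorem posDef_sub_and_inv_le {W D : Matrix d d ℝ} {δ : ℝ} (hW : W.PosDef) (hD : D.PosSemidef)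
    (hδ : (δ • W - D).PosSemidef) (hδ1 : δ < 1) :
    (W - D).PosDef ∧
      (W⁻¹ + (1 - δ)⁻¹ • (W⁻¹ * D * W⁻¹) - (W - D)⁻¹).PosSemidef := by
  obtain ⟨R, R', hR, hR', hRR, hWR, hWR'⟩ := exists_sqrt hW
  have hRR' : R' * R = 1 := mul_eq_one_comm.1 hRR
  have hE : (R' * D * R').PosSemidef := conj_psd hD hR'
  obtain ⟨U, e, hU, hEe, he⟩ := exists_spec_nonneg hE
  have hEδ : (δ • 1 - R' * D * R').PosSemidef := by
    have := conj_psd hδ hR'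
    rwa [mul_sub, sub_mul, hWR, Matrix.mul_smul, Matrix.smul_mul,
      show R' * (R * R) * R' = (R' * R) * (R * R') by simp only [mul_assoc], hRR, hRR',
      one_mul] at this
  have hDE : D = R * (R' * D * R') * R := by
    rw [show R * (R' * D * R') * R = (R * R') * D * (R' * R) by simp only [mul_assoc], hRR, hRR',
      one_mul, mul_one]
  have hsub : W - D = R * (1 - R' * D * R') * R := by
    rw [mul_sub, sub_mul, ← hDE, mul_one, ← hWR]
  rw [hEe, ← spec_one hU, spec_smul, spec_sub, spec_psd_iff hU] at hEδ
  have hlt : ∀ i, e i ≤ δ := fun i => by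
    have := hEδ i
    simp only [Pi.sub_apply, Pi.smul_apply, Pi.one_apply, smul_eq_mul] at this
    linarith
  have hpos : ∀ i, 0 < (1 - e : d → ℝ) i := fun i => by
    have := hlt i
    simp only [Pi.sub_apply, Pi.one_apply]
    linarith
  constructor
  · rw [hsub, hEe, ← spec_one hU, spec_sub]
    have := IsUnit.posDef_star_right_conjugate_iff (x := spec U (1 - e)) (U := R)
      (IsUnit.of_mul_eq_one _ hRR)
    rw [star_eq_conjTranspose, hR.eq] at this
    exact this.2 ((spec_posDef_iff hU).2 hpos)
  · have h1 : W⁻¹ + (1 - δ)⁻¹ • (W⁻¹ * D * W⁻¹) - (W - D)⁻¹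
        = R' * (1 + (1 - δ)⁻¹ • (R' * D * R') - (1 - R' * D * R')⁻¹) * R' := by
      rw [hsub, conj_inv hRR, hWR']
      simp only [mul_add, add_mul, mul_sub, sub_mul, Matrix.mul_smul, Matrix.smul_mul, mul_assoc,
        mul_one]
    rw [h1]
    refine conj_psd ?_ hR'
    rw [hEe, ← spec_one hU, spec_sub, spec_inv hU fun i => (hpos i).ne', spec_smul, spec_add,
      spec_sub, spec_psd_iff hU]
    intro i
    have h2 := hpos i
    have h3 := hlt i
    have h5 : e i * (1 - e i)⁻¹ ≤ e i * (1 - δ)⁻¹ := by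
      refine mul_le_mul_of_nonneg_left ?_ (he i)
      exact inv_anti₀ (by linarith) (by linarith)
    simp only [Pi.sub_apply, Pi.add_apply, Pi.smul_apply, Pi.one_apply, smul_eq_mul] at h2 ⊢
    have h4 : (1 - e i)⁻¹ = 1 + e i * (1 - e i)⁻¹ := by field_simp; ring
    rw [h4]
    linarith

theorem inv_add_le {W D : Matrix d d ℝ} {δ : ℝ} (hW : W.PosDef) (hD : D.PosSemidef)
    (hδ : (δ • W - D).PosSemidef) :
    (W⁻¹ - (1 + δ)⁻¹ • (W⁻¹ * D * W⁻¹) - (W + D)⁻¹).PosSemidef := by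
  obtain ⟨R, R', hR, hR', hRR, hWR, hWR'⟩ := exists_sqrt hW
  have hRR' : R' * R = 1 := mul_eq_one_comm.1 hRR
  have hE : (R' * D * R').PosSemidef := conj_psd hD hR'
  obtain ⟨U, e, hU, hEe, he⟩ := exists_spec_nonneg hE
  have hEδ : (δ • 1 - R' * D * R').PosSemidef := by
    have := conj_psd hδ hR'
    rwa [mul_sub, sub_mul, hWR, Matrix.mul_smul, Matrix.smul_mul,
      show R' * (R * R) * R' = (R' * R) * (R * R') by simp only [mul_assoc], hRR, hRR',
      one_mul] at this
  have hDE : D = R * (R' * D * R') * R := by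
    rw [show R * (R' * D * R') * R = (R * R') * D * (R' * R) by simp only [mul_assoc], hRR, hRR',
      one_mul, mul_one]
  have hadd : W + D = R * (1 + R' * D * R') * R := by
    rw [mul_add, add_mul, ← hDE, mul_one, ← hWR]
  rw [hEe, ← spec_one hU, spec_smul, spec_sub, spec_psd_iff hU] at hEδ
  have hlt : ∀ i, e i ≤ δ := fun i => by
    have := hEδ i
    simp only [Pi.sub_apply, Pi.smul_apply, Pi.one_apply, smul_eq_mul] at this
    linarith
  have hpos : ∀ i, 0 < (1 + e : d → ℝ) i := fun i => by
    have := he i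
    simp only [Pi.add_apply, Pi.one_apply]
    linarith
  have h1 : W⁻¹ - (1 + δ)⁻¹ • (W⁻¹ * D * W⁻¹) - (W + D)⁻¹
      = R' * (1 - (1 + δ)⁻¹ • (R' * D * R') - (1 + R' * D * R')⁻¹) * R' := by
    rw [hadd, conj_inv hRR, hWR']
    simp only [mul_sub, sub_mul, Matrix.mul_smul, Matrix.smul_mul, mul_assoc, mul_one]
  rw [h1]
  refine conj_psd ?_ hR'
  rw [hEe, ← spec_one hU, spec_add, spec_inv hU fun i => (hpos i).ne', spec_smul, spec_sub,
    spec_sub, spec_psd_iff hU]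
  intro i
  have h2 := hpos i
  have h3 := hlt i
  simp only [Pi.sub_apply, Pi.add_apply, Pi.smul_apply, Pi.one_apply, smul_eq_mul] at h2 ⊢
  have h4 : (1 + e i)⁻¹ = 1 - e i * (1 + e i)⁻¹ := by field_simp; ring
  have h5 : e i * (1 + δ)⁻¹ ≤ e i * (1 + e i)⁻¹ := by
    refine mul_le_mul_of_nonneg_left ?_ (he i)
    exact inv_anti₀ (by linarith) (by linarith)
  rw [h4]
  linarith

end InversePerturbation

/-! ### The barrier potential and its change in one step. -/

section Potential

variable {d : Type} [Fintype d] [DecidableEq d]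

/-- The barrier potential `tr exp (W⁻¹)` of a positive definite matrix. -/
noncomputable def pot (W : Matrix d d ℝ) : ℝ := (NormedSpace.exp W⁻¹).trace

/-- `W⁻² exp (W⁻¹)`, the negative of the gradient of `pot` at `W`. -/
noncomputable def grad (W : Matrix d d ℝ) : Matrix d d ℝ := W⁻¹ ^ 2 * NormedSpace.exp W⁻¹

theorem pot_spec {U : Matrix d d ℝ} (hU : Uᵀ * U = 1) {w : d → ℝ} (hw : ∀ i, 0 < w i) :
    pot (spec U w) = ∑ i, Real.exp (w i)⁻¹ := by
  rw [pot, spec_inv hU fun i => (hw i).ne', spec_exp hU, trace_spec hU]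

theorem grad_spec {U : Matrix d d ℝ} (hU : Uᵀ * U = 1) {w : d → ℝ} (hw : ∀ i, 0 < w i) :
    grad (spec U w) = spec U fun i => ((w i)⁻¹) ^ 2 * Real.exp (w i)⁻¹ := by
  rw [grad, spec_inv hU fun i => (hw i).ne', spec_exp hU, spec_pow_two hU, spec_mul hU]
  congr 1; funext i
  simp only [Pi.mul_apply]
  ring

theorem grad_psd {W : Matrix d d ℝ} (hW : W.PosDef) : (grad W).PosSemidef := by
  obtain ⟨U, w, hU, rfl, hw⟩ := exists_spec_pos hW
  rw [grad_spec hU hw, spec_psd_iff hU]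
  exact fun i => mul_nonneg (sq_nonneg _) (Real.exp_pos _).le

theorem trace_conj_mul_exp (W D : Matrix d d ℝ) :
    (W⁻¹ * D * W⁻¹ * NormedSpace.exp W⁻¹).trace = (grad W * D).trace := by
  rw [mul_assoc (W⁻¹), mul_assoc (W⁻¹), trace_mul_comm, mul_assoc D, mul_assoc, mul_assoc,
    ← exp_mul_comm, trace_mul_comm, grad, pow_two]
  simp only [mul_assoc]

theorem conj_inv_le {W D : Matrix d d ℝ} {δ c : ℝ} (hW : W.PosDef) (hc : 0 ≤ c)
    (hδ : (δ • W ^ 2 - D).PosSemidef) : ((c * δ) • 1 - c • (W⁻¹ * D * W⁻¹)).PosSemidef := by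
  have hu := (isUnit_iff_isUnit_det _).1 hW.isUnit
  have h := (conj_psd hδ hW.inv.isHermitian).smul hc
  have : W⁻¹ * W ^ 2 * W⁻¹ = 1 := by
    rw [pow_two, ← mul_assoc, nonsing_inv_mul _ hu, one_mul, mul_nonsing_inv _ hu]
  rwa [mul_sub, sub_mul, Matrix.mul_smul, Matrix.smul_mul, this, smul_sub, smul_smul] at h

/-- The two bounds on `D` have different roles: `D ≼ δW` linearises the inverse, while `D ≼ δW²`
says that `W⁻¹DW⁻¹ ≼ δ`, so that the exponent moves little. -/
theorem pot_sub_le {W D : Matrix d d ℝ} {δ : ℝ} (hW : W.PosDef) (hD : D.PosSemidef)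
    (h₁ : (δ • W - D).PosSemidef) (h₂ : (δ • W ^ 2 - D).PosSemidef) (hδ0 : 0 ≤ δ)
    (hδ1 : δ ≤ 1 / 20) :
    (W - D).PosDef ∧ pot (W - D) ≤ pot W + (1 + 2 * δ) * (grad W * D).trace := by
  obtain ⟨hpd, hle⟩ := posDef_sub_and_inv_le hW hD h₁ (by linarith)
  refine ⟨hpd, ?_⟩
  have hc : 0 < (1 - δ)⁻¹ := inv_pos.2 (by linarith)
  have hX := hW.inv.isHermitian
  have hY : ((1 - δ)⁻¹ • (W⁻¹ * D * W⁻¹)).PosSemidef := (conj_psd hD hX).smul hc.le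
  have hYδ := conj_inv_le hW hc.le h₂
  have hlt : (1 - δ)⁻¹ * δ < 1 := by
    rw [inv_mul_lt_iff₀ (by linarith)]; linarith
  have h3 := trace_exp_mono hpd.inv.isHermitian (hX.add hY.isHermitian) hle
  have h4 := trace_exp_add_le hX hY hYδ (mul_nonneg hc.le hδ0) hlt
  rw [Matrix.smul_mul, trace_smul, trace_conj_mul_exp, smul_eq_mul] at h4
  refine (h3.trans h4).trans (add_le_add_right ?_ _)
  rw [← mul_assoc]
  refine mul_le_mul_of_nonneg_right ?_ (trace_mul_nonneg (grad_psd hW) hD)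
  have e1 : (1 + (1 - δ)⁻¹ * δ) / (1 - (1 - δ)⁻¹ * δ) = (1 - 2 * δ)⁻¹ := by
    have : 1 - δ ≠ 0 := by linarith
    have : 1 - 2 * δ ≠ 0 := by linarith
    have : 1 - (1 - δ)⁻¹ * δ ≠ 0 := by linarith
    field_simp
    ring
  have e2 : (1 - 2 * δ)⁻¹ ≤ 10 / 9 := by
    rw [inv_le_comm₀ (by linarith) (by norm_num)]; linarith
  rw [e1, ← div_eq_mul_inv, div_le_iff₀ (by linarith)]
  -- With `η = δ/(1-δ)` the coefficient is at most `1 + (1/2 + 10/36)η = 1 + 7η/9`, to be compared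
  -- with `(1-δ)(1+2δ) = 1 + δ(1-2δ)`.
  have e3 : (1 - δ)⁻¹ * δ * (7 / 9) ≤ δ * (1 - 2 * δ) := by
    rw [inv_mul_eq_div, div_mul_eq_mul_div, div_le_iff₀ (by linarith)]
    nlinarith [mul_nonneg hδ0 (sub_nonneg.2 hδ1), mul_nonneg (mul_nonneg hδ0 hδ0) hδ0]
  have e4 := mul_le_mul_of_nonneg_left e2 (mul_nonneg hc.le hδ0)
  linarith

theorem pot_add_le {W D : Matrix d d ℝ} {δ : ℝ} (hW : W.PosDef) (hD : D.PosSemidef)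
    (h₁ : (δ • W - D).PosSemidef) (h₂ : (δ • W ^ 2 - D).PosSemidef) (hδ0 : 0 ≤ δ) :
    pot (W + D) ≤ pot W - (1 - 3 * δ / 4) / (1 + δ) * (grad W * D).trace := by
  have hle := inv_add_le hW hD h₁
  have hc : 0 < (1 + δ)⁻¹ := inv_pos.2 (by linarith)
  have hX := hW.inv.isHermitian
  have hY : ((1 + δ)⁻¹ • (W⁻¹ * D * W⁻¹)).PosSemidef := (conj_psd hD hX).smul hc.le
  have hpd := hW.add_posSemidef hD
  have hYδ := conj_inv_le hW hc.le h₂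
  have h3 := trace_exp_mono hpd.inv.isHermitian (hX.sub hY.isHermitian) hle
  have h4 := trace_exp_sub_le hX hY hYδ (mul_nonneg hc.le hδ0)
  rw [Matrix.smul_mul, trace_smul, trace_conj_mul_exp, smul_eq_mul] at h4
  refine (h3.trans h4).trans (sub_le_sub_left ?_ _)
  rw [← mul_assoc, div_eq_mul_inv]
  refine mul_le_mul_of_nonneg_right (mul_le_mul_of_nonneg_right ?_ hc.le)
    (trace_mul_nonneg (grad_psd hW) hD)
  have : (1 + δ)⁻¹ * δ ≤ δ := by
    rw [inv_mul_le_iff₀ (by linarith)]; nlinarith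
  linarith

/-- Put `h = q x²`. The exponent then drops by exactly `q/(1+qx) ≥ q/(1+q)`, whatever the size of
`1/x`, so the exponential is multiplied by at most `1 - (1-4ε)q`. -/
theorem exp_inv_add_le {x h ε : ℝ} (hx : 0 < x) (hx1 : x ≤ 1) (hh : 0 ≤ h)
    (hhx : h ≤ 3 / 2 * ε * x ^ 2) (hε : 0 < ε) :
    Real.exp (x + h)⁻¹
      ≤ Real.exp x⁻¹ - (1 - 4 * ε) * h * (x⁻¹ ^ 2 * Real.exp x⁻¹) := by
  obtain ⟨q, rfl⟩ : ∃ q, h = q * x ^ 2 := ⟨h / x ^ 2, by field_simp⟩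
  have hq : q ≤ 3 / 2 * ε := le_of_mul_le_mul_right hhx (by positivity)
  have hq0 : 0 ≤ q := nonneg_of_mul_nonneg_left hh (by positivity)
  have e1 : (x + q * x ^ 2)⁻¹ = x⁻¹ + -(q / (1 + q * x)) := by
    have : 1 + q * x ≠ 0 := by positivity
    have : x + q * x ^ 2 ≠ 0 := by positivity
    field_simp
    ring
  have e2 : (1 - 4 * ε) * (q * x ^ 2) * (x⁻¹ ^ 2 * Real.exp x⁻¹)
      = Real.exp x⁻¹ * ((1 - 4 * ε) * q) := by field_simp
  rw [e1, e2, Real.exp_add, ← mul_one_sub]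
  refine mul_le_mul_of_nonneg_left ?_ (Real.exp_pos _).le
  have e3 : q / (1 + q) ≤ q / (1 + q * x) :=
    div_le_div_of_nonneg_left hq0 (by positivity) (by nlinarith)
  have e4 : Real.exp (-(q / (1 + q * x))) ≤ Real.exp (-(q / (1 + q))) :=
    Real.exp_le_exp.2 (neg_le_neg e3)
  have e5 : Real.exp (-(q / (1 + q))) ≤ (1 + q / (1 + q))⁻¹ := by
    rw [Real.exp_neg]
    exact inv_anti₀ (by positivity) (by linarith [Real.add_one_le_exp (q / (1 + q))])
  refine (e4.trans e5).trans ?_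
  have e6 : 1 + q / (1 + q) = (1 + 2 * q) / (1 + q) := by field_simp; ring
  rw [e6, inv_div, div_le_iff₀ (by positivity)]
  nlinarith [mul_nonneg hq0 hε.le, mul_nonneg hq0 (mul_nonneg hq0 hε.le),
    mul_nonneg hq0 (sub_nonneg.2 hq)]

theorem exp_inv_sub_le {x h ε : ℝ} (hx : 0 < x) (hx1 : x ≤ 1) (hh : 0 ≤ h)
    (hhx : h ≤ ε * x ^ 2) (hε : 0 < ε) (hε1 : ε < 1 / 20) :
    Real.exp (x - h)⁻¹
      ≤ Real.exp x⁻¹ + (1 + 4 * ε) * h * (x⁻¹ ^ 2 * Real.exp x⁻¹) := by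
  obtain ⟨q, rfl⟩ : ∃ q, h = q * x ^ 2 := ⟨h / x ^ 2, by field_simp⟩
  have hq : q ≤ ε := le_of_mul_le_mul_right hhx (by positivity)
  have hq0 : 0 ≤ q := nonneg_of_mul_nonneg_left hh (by positivity)
  have hqx : q * x ≤ q := by nlinarith
  have h1 : 0 < 1 - q * x := by linarith
  have e1 : (x - q * x ^ 2)⁻¹ = x⁻¹ + q / (1 - q * x) := by
    have e : x - q * x ^ 2 = x * (1 - q * x) := by ring
    have h1' : 1 - x * q ≠ 0 := by rw [mul_comm]; exact h1.ne'
    rw [e, mul_comm q x]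
    field_simp
    ring
  have e2 : (1 + 4 * ε) * (q * x ^ 2) * (x⁻¹ ^ 2 * Real.exp x⁻¹)
      = Real.exp x⁻¹ * ((1 + 4 * ε) * q) := by field_simp
  rw [e1, e2, Real.exp_add, ← mul_one_add]
  refine mul_le_mul_of_nonneg_left ?_ (Real.exp_pos _).le
  have h2 : 0 < 1 - q := by linarith
  have e3 : q / (1 - q * x) ≤ q / (1 - q) :=
    div_le_div_of_nonneg_left hq0 h2 (by linarith)
  have h3 : 0 < 1 - q / (1 - q) := by
    rw [sub_pos, div_lt_one h2]; linarith
  have e5 : Real.exp (q / (1 - q)) ≤ (1 - q / (1 - q))⁻¹ := by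
    rw [← inv_inv (Real.exp _), ← Real.exp_neg]
    exact inv_anti₀ h3 (by linarith [Real.add_one_le_exp (-(q / (1 - q)))])
  refine ((Real.exp_le_exp.2 e3).trans e5).trans ?_
  have e6 : 1 - q / (1 - q) = (1 - 2 * q) / (1 - q) := by
    have := h2.ne'
    field_simp; ring
  rw [e6, inv_div, div_le_iff₀ (by linarith)]
  nlinarith [mul_nonneg hq0 hε.le, mul_nonneg hq0 (sub_nonneg.2 hq),
    mul_nonneg (mul_nonneg hq0 hε.le) (sub_nonneg.2 (hq.trans hε1.le))]

theorem inv_sq_mul_exp_antitone {x y : ℝ} (hx : 0 < x) (hxy : x ≤ y) :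
    y⁻¹ ^ 2 * Real.exp y⁻¹ ≤ x⁻¹ ^ 2 * Real.exp x⁻¹ := by
  have h := inv_anti₀ hx hxy
  have hy : 0 < y⁻¹ := inv_pos.2 (hx.trans_le hxy)
  gcongr

/-- The potential of the upper barrier after one iteration. -/
theorem pot_upper_step {W D : Matrix d d ℝ} {ε h : ℝ} (hW : W.PosDef) (hW1 : (1 - W).PosSemidef)
    (hD : D.PosSemidef) (hDW : (W ^ 2 - D).PosSemidef) (hε : 0 < ε) (hε1 : ε < 1 / 20)
    (hh : 0 ≤ h) (hhW : ((3 / 2 * ε) • W ^ 2 - h • 1).PosSemidef) :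
    (W + h • 1 - ε • D).PosDef ∧
      pot (W + h • 1 - ε • D) ≤ pot W - (1 - 4 * ε) * h * (grad W).trace
        + ε * (1 + 2 * ε) * (grad W * D).trace := by
  obtain ⟨U, w, hU, hWw, hw⟩ := exists_spec_pos hW
  have hw1 : ∀ i, w i ≤ 1 := by
    rw [hWw, ← spec_one hU, spec_sub, spec_psd_iff hU] at hW1
    exact fun i => by simpa using hW1 i
  have hhw : ∀ i, h ≤ 3 / 2 * ε * w i ^ 2 := by
    rw [hWw, ← spec_one hU, spec_pow_two hU, spec_smul, spec_smul, spec_sub,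
      spec_psd_iff hU] at hhW
    intro i
    have := hhW i
    simp only [Pi.sub_apply, Pi.smul_apply, Pi.mul_apply, Pi.one_apply, smul_eq_mul] at this
    nlinarith
  -- The barrier is moved before `A`: the shift commutes with `W`, so its effect is scalar.
  have hW' : W + h • 1 = spec U fun i => w i + h := by
    rw [hWw, ← spec_one hU, spec_smul, spec_add]
    congr 1; funext i; simp
  have hw' : ∀ i, 0 < w i + h := fun i => by linarith [hw i]
  have hpd : (W + h • 1).PosDef := by rw [hW']; exact (spec_posDef_iff hU).2 hw'
  have hεD : (ε • W ^ 2 - ε • D).PosSemidef := by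
    rw [← smul_sub]; exact hDW.smul hε.le
  have h1 : (ε • (W + h • 1) - ε • D).PosSemidef := by
    refine psd_sub_trans hεD ?_
    rw [← smul_sub]
    refine PosSemidef.smul ?_ hε.le
    rw [hW', hWw, spec_pow_two hU, spec_sub, spec_psd_iff hU]
    intro i
    simp only [Pi.sub_apply, Pi.mul_apply]
    nlinarith [hw i, hw1 i]
  have h2 : (ε • (W + h • 1) ^ 2 - ε • D).PosSemidef := by
    refine psd_sub_trans hεD ?_
    rw [← smul_sub]
    refine PosSemidef.smul ?_ hε.le
    rw [hW', hWw, spec_pow_two hU, spec_pow_two hU, spec_sub, spec_psd_iff hU]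
    intro i
    simp only [Pi.sub_apply, Pi.mul_apply]
    nlinarith [hw i]
  obtain ⟨hpd', hle⟩ := pot_sub_le hpd (hD.smul hε.le) h1 h2 hε.le hε1.le
  refine ⟨hpd', hle.trans ?_⟩
  have h3 : pot (W + h • 1) ≤ pot W - (1 - 4 * ε) * h * (grad W).trace := by
    rw [hW', hWw, pot_spec hU hw', pot_spec hU hw, grad_spec hU hw, trace_spec hU, Finset.mul_sum,
      ← Finset.sum_sub_distrib]
    exact Finset.sum_le_sum fun i _ => exp_inv_add_le (hw i) (hw1 i) hh (hhw i) hε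
  -- Widening the gap decreases the gradient, so the old gap may be used.
  have h4 : (grad (W + h • 1) * D).trace ≤ (grad W * D).trace := by
    refine trace_mul_le ?_ hD
    rw [hW', hWw, grad_spec hU hw', grad_spec hU hw, spec_sub, spec_psd_iff hU]
    exact fun i => sub_nonneg.2 (inv_sq_mul_exp_antitone (hw i) (by linarith))
  rw [Matrix.mul_smul, trace_smul, smul_eq_mul]
  have := mul_le_mul_of_nonneg_left h4 (show 0 ≤ ε * (1 + 2 * ε) by positivity)
  linarith

/-- The potential of the lower barrier after one iteration. -/
theorem pot_lower_step {W D : Matrix d d ℝ} {ε h : ℝ} (hW : W.PosDef) (hW1 : (1 - W).PosSemidef)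
    (hD : D.PosSemidef) (hDW : (W ^ 2 - D).PosSemidef) (hε : 0 < ε) (hε1 : ε < 1 / 20)
    (hh : 0 ≤ h) (hhW : (ε • W ^ 2 - h • 1).PosSemidef) :
    (W - h • 1 + ε • D).PosDef ∧
      pot (W - h • 1 + ε • D) ≤ pot W + (1 + 4 * ε) * h * (grad W).trace
        - ε * (1 - 2 * ε) * (grad W * D).trace := by
  obtain ⟨U, w, hU, hWw, hw⟩ := exists_spec_pos hW
  have hw1 : ∀ i, w i ≤ 1 := by
    rw [hWw, ← spec_one hU, spec_sub, spec_psd_iff hU] at hW1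
    exact fun i => by simpa using hW1 i
  have hhw : ∀ i, h ≤ ε * w i ^ 2 := by
    rw [hWw, ← spec_one hU, spec_pow_two hU, spec_smul, spec_smul, spec_sub,
      spec_psd_iff hU] at hhW
    intro i
    have := hhW i
    simp only [Pi.sub_apply, Pi.smul_apply, Pi.mul_apply, Pi.one_apply, smul_eq_mul] at this
    nlinarith
  have hwε : ∀ i, w i * (1 - ε) ≤ w i - h := fun i => by
    have := mul_nonneg (mul_nonneg hε.le (hw i).le) (sub_nonneg.2 (hw1 i))
    nlinarith [hhw i]
  have hW' : W - h • 1 = spec U fun i => w i - h := by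
    rw [hWw, ← spec_one hU, spec_smul, spec_sub]
    congr 1; funext i; simp
  have hw' : ∀ i, 0 < w i - h := fun i =>
    (mul_pos (hw i) (by linarith)).trans_le (hwε i)
  have hpd : (W - h • 1).PosDef := by rw [hW']; exact (spec_posDef_iff hU).2 hw'
  have hεD : (ε • W ^ 2 - ε • D).PosSemidef := by
    rw [← smul_sub]; exact hDW.smul hε.le
  have hε2 : 0 < (1 - ε) ^ 2 := by nlinarith
  -- Moving the lower barrier shrinks the gap by a factor no smaller than `1-ε`, so `D ≼ W²` becomes
  -- `D ≼ (1-ε)⁻² (W-h)²`.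
  set δ := ε / (1 - ε) ^ 2 with hδ
  have hδ0 : 0 ≤ δ := by positivity
  have hδε : δ * (1 - ε) ^ 2 = ε := div_mul_cancel₀ _ hε2.ne'
  have h2' : (δ • (W - h • 1) ^ 2 - ε • W ^ 2).PosSemidef := by
    rw [hW', hWw, spec_pow_two hU, spec_pow_two hU, spec_smul, spec_smul, spec_sub,
      spec_psd_iff hU]
    intro i
    simp only [Pi.sub_apply, Pi.mul_apply, Pi.smul_apply, smul_eq_mul]
    rw [← hδε, mul_assoc, ← mul_sub]
    refine mul_nonneg hδ0 ?_
    have h0 : 0 ≤ w i * (1 - ε) := mul_nonneg (hw i).le (by linarith)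
    nlinarith [hwε i]
  have h2 : (δ • (W - h • 1) ^ 2 - ε • D).PosSemidef := psd_sub_trans hεD h2'
  have h1 : (δ • (W - h • 1) - ε • D).PosSemidef := by
    refine psd_sub_trans h2 ?_
    rw [← smul_sub]
    refine PosSemidef.smul ?_ hδ0
    rw [hW', spec_pow_two hU, spec_sub, spec_psd_iff hU]
    intro i
    simp only [Pi.sub_apply, Pi.mul_apply]
    nlinarith [hw' i, hw1 i]
  refine ⟨hpd.add_posSemidef (hD.smul hε.le),
    (pot_add_le hpd (hD.smul hε.le) h1 h2 hδ0).trans ?_⟩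
  have h3 : pot (W - h • 1) ≤ pot W + (1 + 4 * ε) * h * (grad W).trace := by
    rw [hW', hWw, pot_spec hU hw', pot_spec hU hw, grad_spec hU hw, trace_spec hU, Finset.mul_sum,
      ← Finset.sum_add_distrib]
    exact Finset.sum_le_sum fun i _ => exp_inv_sub_le (hw i) (hw1 i) hh (hhw i) hε hε1
  -- Shrinking the gap increases the gradient, which helps because this term is subtracted.
  have h4 : (grad W * D).trace ≤ (grad (W - h • 1) * D).trace := by
    refine trace_mul_le ?_ hD
    rw [hW', hWw, grad_spec hU hw', grad_spec hU hw, spec_sub, spec_psd_iff hU]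
    exact fun i => sub_nonneg.2 (inv_sq_mul_exp_antitone (hw' i) (by linarith))
  have h5 : 1 - 2 * ε ≤ (1 - 3 * δ / 4) / (1 + δ) := by
    rw [le_div_iff₀ (by linarith)]
    have : 7 / 4 * δ ≤ 2 * ε := by
      rw [← hδε]
      have : (7 : ℝ) / 4 ≤ 2 * (1 - ε) ^ 2 := by nlinarith
      nlinarith
    nlinarith [mul_nonneg hε.le hδ0]
  rw [Matrix.mul_smul, trace_smul, smul_eq_mul]
  have h6 := trace_mul_nonneg (grad_psd hW) hD
  have h7 := mul_le_mul h5 (mul_le_mul_of_nonneg_left h4 hε.le) (mul_nonneg hε.le h6)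
    ((by linarith : (0 : ℝ) ≤ 1 - 2 * ε).trans h5)
  linarith

end Potential

/-! ### The smallest eigenvalue and the PSD order. -/

section LambdaMin

variable {d : Type} [Fintype d] [DecidableEq d]

theorem psd_sub_lambdaMin {B : Matrix d d ℝ} (hB : B.IsHermitian) :
    (B - lambdaMin B • 1).PosSemidef := by
  have hle : ∀ i, lambdaMin B ≤ hB.eigenvalues i := fun i =>
    csInf_le finite_real_spectrum.bddBelow (hB.eigenvalues_mem_spectrum_real i)
  obtain ⟨U, hU, h⟩ := exists_spec_eigenvalues hB
  generalize lambdaMin B = μ at *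
  generalize hB.eigenvalues = b at *
  rw [h, ← spec_one hU, spec_smul, spec_sub, spec_psd_iff hU]
  intro i
  have := hle i
  simp only [Pi.sub_apply, Pi.smul_apply, Pi.one_apply, smul_eq_mul]
  linarith

theorem le_lambdaMin [Nonempty d] {B : Matrix d d ℝ} (hB : B.IsHermitian) {μ : ℝ}
    (h : (B - μ • 1).PosSemidef) : μ ≤ lambdaMin B := by
  rw [lambdaMin, hB.spectrum_real_eq_range_eigenvalues]
  refine le_csInf (Set.range_nonempty _) ?_
  rintro _ ⟨i, rfl⟩
  obtain ⟨U, hU, hB'⟩ := exists_spec_eigenvalues hB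
  generalize hB.eigenvalues = b at *
  rw [hB', ← spec_one hU, spec_smul, spec_sub, spec_psd_iff hU] at h
  have := h i
  simp only [Pi.sub_apply, Pi.smul_apply, Pi.one_apply, smul_eq_mul] at this
  linarith

omit [Fintype d] in
theorem le_of_smul_one_psd [Nonempty d] {a b : ℝ}
    (h : ((b • 1 - a • 1 : Matrix d d ℝ)).PosSemidef) : a ≤ b := by
  have i : d := Classical.arbitrary d
  have := h.diag_nonneg (i := i)
  simpa using this

theorem lambdaMin_le_one [Nonempty d] {B : Matrix d d ℝ} (hB : B.IsHermitian)
    (h : (1 - B).PosSemidef) : lambdaMin B ≤ 1 := by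
  apply le_of_smul_one_psd (d := d)
  rw [one_smul]
  exact psd_sub_trans (psd_sub_lambdaMin hB) h

theorem lambdaMin_pos [Nonempty d] {B : Matrix d d ℝ} (hB : B.PosDef) : 0 < lambdaMin B := by
  have hmem : lambdaMin B ∈ spectrum ℝ B := by
    refine Set.Nonempty.csInf_mem ?_ finite_real_spectrum
    rw [hB.isHermitian.spectrum_real_eq_range_eigenvalues]
    exact Set.range_nonempty _
  rw [hB.isHermitian.spectrum_real_eq_range_eigenvalues] at hmem
  obtain ⟨i, hi⟩ := hmem
  exact hi ▸ hB.eigenvalues_pos i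

end LambdaMin

/-! ### Block-diagonal matrices. -/

section DirectSum

variable {d ι : Type} [Fintype ι]

theorem directSum_sub (A B A' B' : Matrix d d ℝ) :
    directSum A B - directSum A' B' = directSum (A - A') (B - B') := by
  rw [directSum, directSum, directSum, sub_eq_add_neg, fromBlocks_neg, fromBlocks_add]
  simp [sub_eq_add_neg]

theorem directSum_smul (c : ℝ) (A B : Matrix d d ℝ) :
    c • directSum A B = directSum (c • A) (c • B) := by
  rw [directSum, directSum, fromBlocks_smul]
  simp

theorem directSum_add (A B A' B' : Matrix d d ℝ) :
    directSum A B + directSum A' B' = directSum (A + A') (B + B') := by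
  rw [directSum, directSum, directSum, fromBlocks_add, add_zero]

theorem directSum_one [DecidableEq d] : directSum (1 : Matrix d d ℝ) 1 = 1 := fromBlocks_one

theorem directSum_sum (A B : ι → Matrix d d ℝ) :
    ∑ i, directSum (A i) (B i) = directSum (∑ i, A i) (∑ i, B i) := by
  ext i j
  rcases i with i | i <;> rcases j with j | j <;> simp [directSum, Matrix.sum_apply]

theorem combo_directSum (M : ι → Matrix d d ℝ) (α : ι → ℝ) :
    combo (fun i => directSum (M i) (M i)) α = directSum (combo M α) (combo M α) := by
  simp only [combo, directSum_smul, directSum_sum]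

variable [Fintype d]

theorem trace_directSum (A B : Matrix d d ℝ) : (directSum A B).trace = A.trace + B.trace := by
  simp [directSum, trace, Fintype.sum_sum_type]

theorem directSum_mul (A B A' B' : Matrix d d ℝ) :
    directSum A B * directSum A' B' = directSum (A * A') (B * B') := by
  rw [directSum, directSum, directSum, fromBlocks_multiply]
  simp

theorem directSum_inv [DecidableEq d] {A B : Matrix d d ℝ} (hA : IsUnit A) (hB : IsUnit B) :
    (directSum A B)⁻¹ = directSum A⁻¹ B⁻¹ := by
  apply inv_eq_right_inv
  rw [directSum_mul, mul_nonsing_inv _ ((isUnit_iff_isUnit_det _).1 hA),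
    mul_nonsing_inv _ ((isUnit_iff_isUnit_det _).1 hB), directSum_one]

omit [Fintype d] in
theorem directSum_isHermitian {A B : Matrix d d ℝ} (hA : A.IsHermitian) (hB : B.IsHermitian) :
    (directSum A B).IsHermitian := by
  rw [IsHermitian, directSum, fromBlocks_conjTranspose, hA.eq, hB.eq, conjTranspose_zero]

theorem directSum_psd {A B : Matrix d d ℝ} (hA : A.PosSemidef) (hB : B.PosSemidef) :
    (directSum A B).PosSemidef := by
  refine PosSemidef.of_dotProduct_mulVec_nonneg
    (directSum_isHermitian hA.isHermitian hB.isHermitian) fun x => ?_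
  have h1 := hA.dotProduct_mulVec_nonneg (x ∘ Sum.inl)
  have h2 := hB.dotProduct_mulVec_nonneg (x ∘ Sum.inr)
  rw [directSum, fromBlocks_mulVec, dotProduct, Fintype.sum_sum_type]
  simpa [dotProduct] using add_nonneg h1 h2

theorem directSum_posDef [DecidableEq d] {A B : Matrix d d ℝ} (hA : A.PosDef) (hB : B.PosDef) :
    (directSum A B).PosDef := by
  refine PosDef.of_dotProduct_mulVec_pos
    (directSum_isHermitian hA.isHermitian hB.isHermitian) fun x hx => ?_
  have h1 := hA.posSemidef.dotProduct_mulVec_nonneg (x ∘ Sum.inl)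
  have h2 := hB.posSemidef.dotProduct_mulVec_nonneg (x ∘ Sum.inr)
  have h3 : 0 < star (x ∘ Sum.inl) ⬝ᵥ (A *ᵥ (x ∘ Sum.inl))
      + star (x ∘ Sum.inr) ⬝ᵥ (B *ᵥ (x ∘ Sum.inr)) := by
    by_cases hl : x ∘ Sum.inl = 0
    · have hr : x ∘ Sum.inr ≠ 0 := by
        intro hr
        apply hx
        funext i
        rcases i with i | i
        · exact congrFun hl i
        · exact congrFun hr i
      exact add_pos_of_nonneg_of_pos h1 (hB.dotProduct_mulVec_pos hr)
    · exact add_pos_of_pos_of_nonneg (hA.dotProduct_mulVec_pos hl) h2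
  rw [directSum, fromBlocks_mulVec, dotProduct, Fintype.sum_sum_type]
  simpa [dotProduct] using h3

omit [Fintype d] in
theorem psd_of_directSum {A B : Matrix d d ℝ} (h : (directSum A B).PosSemidef) :
    A.PosSemidef ∧ B.PosSemidef :=
  ⟨h.submatrix Sum.inl, h.submatrix Sum.inr⟩

end DirectSum

/-! ### Means over discrete laws. -/

section PMF

/-- The mean of a nonnegative function. -/
noncomputable def mean {α : Type*} (p : PMF α) (f : α → ENNReal) : ENNReal := ∑' a, p a * f a

theorem mean_pure {α : Type*} (a : α) (f : α → ENNReal) : mean (PMF.pure a) f = f a := by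
  rw [mean, tsum_eq_single a]
  · simp
  · intro b hb
    simp [hb]

theorem mean_bind {α β : Type*} (p : PMF α) (g : α → PMF β) (f : β → ENNReal) :
    mean (p.bind g) f = mean p fun a => mean (g a) f := by
  simp only [mean, PMF.bind_apply, ← ENNReal.tsum_mul_right, ← ENNReal.tsum_mul_left]
  rw [ENNReal.tsum_comm]
  simp only [mul_assoc]

theorem mean_map {α β : Type*} (p : PMF α) (g : α → β) (f : β → ENNReal) :
    mean (p.map g) f = mean p fun a => f (g a) := by
  rw [← PMF.bind_pure_comp, mean_bind]
  simp only [Function.comp_apply, mean_pure]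

theorem mean_mono {α : Type*} (p : PMF α) {f g : α → ENNReal}
    (h : ∀ a ∈ p.support, f a ≤ g a) : mean p f ≤ mean p g := by
  refine ENNReal.tsum_le_tsum fun a => ?_
  by_cases ha : p a = 0
  · simp [ha]
  · exact mul_le_mul_right (h a ((PMF.mem_support_iff _ _).2 ha)) _

theorem summable_toReal {α : Type*} (p : PMF α) : Summable fun a => (p a).toReal :=
  ENNReal.summable_toReal p.tsum_coe_ne_top

theorem mean_const_le {α : Type*} (p : PMF α) {f : α → ENNReal} {c : ENNReal}
    (h : ∀ a ∈ p.support, f a ≤ c) : mean p f ≤ c := by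
  refine (mean_mono p h).trans_eq ?_
  rw [mean, ENNReal.tsum_mul_right, p.tsum_coe, one_mul]

/-- A nonnegative function below an affine function of a bounded real function `X` has mean at
most the corresponding affine function of the mean of `X`. -/
theorem mean_ofReal_le {α : Type*} (p : PMF α) {F X : α → ℝ} {a e b c : ℝ}
    (hF : ∀ x ∈ p.support, 0 ≤ F x) (hFX : ∀ x ∈ p.support, F x ≤ a - e * X x)
    (hX : ∀ x ∈ p.support, |X x| ≤ b) (hc : a - e * ∑' x, (p x).toReal * X x ≤ c) :
    mean p (fun x => ENNReal.ofReal (F x)) ≤ ENNReal.ofReal c := by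
  have hs := summable_toReal p
  have hsX : Summable fun x => (p x).toReal * X x := by
    refine Summable.of_norm_bounded (hs.mul_right b) fun x => ?_
    rw [Real.norm_eq_abs, abs_mul, abs_of_nonneg ENNReal.toReal_nonneg]
    by_cases hx : p x = 0
    · simp [hx]
    · exact mul_le_mul_of_nonneg_left (hX x ((PMF.mem_support_iff _ _).2 hx))
        ENNReal.toReal_nonneg
  have h1 : ∑' x, (p x).toReal = 1 := by
    rw [← ENNReal.tsum_toReal_eq p.apply_ne_top, p.tsum_coe, ENNReal.toReal_one]
  have hg : Summable fun x => (p x).toReal * (a - e * X x) := by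
    refine ((hs.mul_right a).sub (hsX.mul_left e)).congr fun x => ?_
    ring
  have hg' : ∑' x, (p x).toReal * (a - e * X x) = a - e * ∑' x, (p x).toReal * X x := by
    have h2 := (hs.mul_right a).tsum_sub (hsX.mul_left e)
    rw [tsum_mul_right, tsum_mul_left, h1, one_mul] at h2
    rw [← h2]
    refine tsum_congr fun x => ?_
    ring
  have hg0 : ∀ x, 0 ≤ (p x).toReal * (a - e * X x) := fun x => by
    by_cases hx : p x = 0
    · simp [hx]
    · have := (PMF.mem_support_iff _ _).2 hx
      exact mul_nonneg ENNReal.toReal_nonneg ((hF x this).trans (hFX x this))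
  refine le_trans ?_ (ENNReal.ofReal_le_ofReal (hg'.trans_le hc))
  rw [ENNReal.ofReal_tsum_of_nonneg hg0 hg]
  refine ENNReal.tsum_le_tsum fun x => ?_
  by_cases hx : p x = 0
  · simp [hx]
  · rw [ENNReal.ofReal_mul ENNReal.toReal_nonneg, ENNReal.ofReal_toReal (p.apply_ne_top x)]
    exact mul_le_mul_right
      (ENNReal.ofReal_le_ofReal (hFX x ((PMF.mem_support_iff _ _).2 hx))) _

end PMF

/-! ### Numerical bounds on the barrier speeds. -/

section Rates

/-- The coefficient of `ε S λ_min(B)` in the increase of the upper barrier. -/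
noncomputable def upperRate (ε : ℝ) : ℝ := (1 + 2 * ε) * (1 + ε) / (1 - 4 * ε)

/-- The coefficient of `ε S λ_min(B)` in the increase of the lower barrier. -/
noncomputable def lowerRate (ε : ℝ) : ℝ := (1 - 2 * ε) * (1 - ε) / (1 + 4 * ε)

variable {ε : ℝ}

theorem upperRate_le (hε : 0 < ε) (hε1 : ε < 1 / 20) : upperRate ε ≤ 3 / 2 := by
  rw [upperRate, div_le_iff₀ (by linarith)]; nlinarith

theorem upperRate_pos (hε : 0 < ε) (hε1 : ε < 1 / 20) : 0 < upperRate ε := by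
  refine div_pos (by positivity) (by linarith)

theorem lowerRate_le (hε : 0 < ε) (hε1 : ε < 1 / 20) : lowerRate ε ≤ 1 := by
  rw [lowerRate, div_le_iff₀ (by linarith)]; nlinarith

theorem lowerRate_pos (hε : 0 < ε) (hε1 : ε < 1 / 20) : 0 < lowerRate ε := by
  refine div_pos (mul_pos (by linarith) (by linarith)) (by linarith)

/-- Over the common denominator `1 - 16ε²` the numerator is `14ε + 16ε³`. -/
theorem le_upperRate_sub (hε : 0 < ε) (hε1 : ε < 1 / 20) :
    14 * ε ≤ upperRate ε - lowerRate ε := by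
  rw [upperRate, lowerRate, div_sub_div _ _ (by linarith) (by linarith),
    le_div_iff₀ (mul_pos (by linarith) (by linarith))]
  nlinarith [pow_pos hε 3]

/-- The numerators are `14ε + 16ε³` for the difference and `2 + 28ε²` for the sum. -/
theorem upperRate_sub_le (hε : 0 < ε) (hε1 : ε < 1 / 20) :
    upperRate ε - lowerRate ε ≤ 7 * ε * (upperRate ε + lowerRate ε) := by
  rw [upperRate, lowerRate, div_sub_div _ _ (by linarith) (by linarith),
    div_add_div _ _ (by linarith) (by linarith), mul_div_assoc']
  refine div_le_div_of_nonneg_right ?_ (mul_pos (by linarith) (by linarith)).le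
  nlinarith [pow_pos hε 3]

end Rates

/-! ### One iteration: the expected potential does not increase. -/

section Step

variable {n m : ℕ}

/-- The potential of a state. -/
noncomputable def State.potential (s : State n m) : ℝ := pot s.upperGap + pot s.lowerGap

/-- `A` lies strictly between the barriers, and the barriers are less than `1` apart. -/
structure State.Active (s : State n m) : Prop where
  upper : s.upperGap.PosDef
  lower : s.lowerGap.PosDef
  lt_one : s.u - s.l < 1

variable {s : State n m}

theorem pot_nonneg {d : Type} [Fintype d] [DecidableEq d] {W : Matrix d d ℝ} (hW : W.PosDef) :
    0 ≤ pot W :=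
  (exp_psd hW.inv.isHermitian).trace_nonneg

theorem gap_add_gap (s : State n m) : s.upperGap + s.lowerGap = (s.u - s.l) • 1 := by
  rw [State.upperGap, State.lowerGap, sub_smul]; abel

theorem State.Active.upperGap_le (h : s.Active) : (1 - s.upperGap).PosSemidef := by
  have h1 : 1 - s.upperGap = s.lowerGap + (1 - (s.u - s.l)) • 1 := by
    rw [sub_smul, ← gap_add_gap, one_smul]; abel
  rw [h1]
  exact h.lower.posSemidef.add (PosSemidef.one.smul (by linarith [h.lt_one]))

theorem State.Active.lowerGap_le (h : s.Active) : (1 - s.lowerGap).PosSemidef := by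
  have h1 : 1 - s.lowerGap = s.upperGap + (1 - (s.u - s.l)) • 1 := by
    rw [sub_smul, ← gap_add_gap, one_smul]; abel
  rw [h1]
  exact h.upper.posSemidef.add (PosSemidef.one.smul (by linarith [h.lt_one]))

theorem pow_two_posDef {d : Type} [Fintype d] [DecidableEq d] {W : Matrix d d ℝ} (hW : W.PosDef) :
    (W ^ 2).PosDef := by
  obtain ⟨U, w, hU, rfl, hw⟩ := exists_spec_pos hW
  rw [spec_pow_two hU, spec_posDef_iff hU]
  exact fun i => mul_pos (hw i) (hw i)

theorem one_sub_pow_two_psd {d : Type} [Fintype d] [DecidableEq d] {W : Matrix d d ℝ}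
    (hW : W.PosDef) (hW1 : (1 - W).PosSemidef) : (1 - W ^ 2).PosSemidef := by
  obtain ⟨U, w, hU, rfl, hw⟩ := exists_spec_pos hW
  rw [← spec_one hU, spec_sub, spec_psd_iff hU] at hW1
  rw [spec_pow_two hU, ← spec_one hU, spec_sub, spec_psd_iff hU]
  intro i
  have h1 := hW1 i
  have h2 := hw i
  simp only [Pi.sub_apply, Pi.mul_apply, Pi.one_apply] at h1 ⊢
  nlinarith

theorem State.Active.B_posDef (h : s.Active) : s.B.PosDef :=
  directSum_posDef (pow_two_posDef h.upper) (pow_two_posDef h.lower)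

theorem State.Active.one_sub_B (h : s.Active) : (1 - s.B).PosSemidef := by
  rw [State.B, ← directSum_one, directSum_sub]
  exact directSum_psd (one_sub_pow_two_psd h.upper h.upperGap_le)
    (one_sub_pow_two_psd h.lower h.lowerGap_le)

theorem Cplus_eq (ε : ℝ) (s : State n m) : s.Cplus ε = (1 - 2 * ε) • grad s.lowerGap := rfl

theorem Cminus_eq (ε : ℝ) (s : State n m) : s.Cminus ε = (1 + 2 * ε) • grad s.upperGap := rfl

theorem lambdaMin_smul_le (h : s.Active) :
    (s.upperGap ^ 2 - lambdaMin s.B • 1).PosSemidef ∧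
      (s.lowerGap ^ 2 - lambdaMin s.B • 1).PosSemidef := by
  have h1 := psd_sub_lambdaMin h.B_posDef.isHermitian
  rw [← directSum_one, directSum_smul] at h1
  nth_rw 1 [State.B] at h1
  rw [directSum_sub] at h1
  exact psd_of_directSum h1

theorem smul_sub_smul_one_psd {d : Type} [Fintype d] [DecidableEq d] {W : Matrix d d ℝ}
    {lam a b : ℝ} (hW : (W - lam • 1).PosSemidef) (ha : 0 ≤ a) (hb : b ≤ a * lam) :
    (a • W - b • 1).PosSemidef := by
  have h := (hW.smul ha).add ((PosSemidef.one (n := d) (R := ℝ)).smul (sub_nonneg.2 hb))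
  rwa [smul_sub, smul_smul, sub_smul, sub_add_sub_cancel] at h

/-- The inner product in the oracle's guarantee. -/
noncomputable def State.gain (M : Fin m → Matrix (Fin n) (Fin n) ℝ) (ε : ℝ) (s : State n m)
    (α : Fin m → ℝ) : ℝ :=
  (1 - 2 * ε) * (grad s.lowerGap * combo M α).trace
    - (1 + 2 * ε) * (grad s.upperGap * combo M α).trace

theorem half_directSum_sub (C C' : Matrix (Fin n) (Fin n) ℝ) :
    (1 / 2 : ℝ) • directSum C C - (1 / 2 : ℝ) • directSum C' C'
      = (1 / 2 : ℝ) • directSum (C - C') (C - C') := by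
  rw [← smul_sub, directSum_sub]

/-- The factor `1/2` in the query offsets the double count in `Δ ⊕ Δ`; the transpose disappears by
symmetry. -/
theorem matInner_eq_gain (M : Fin m → Matrix (Fin n) (Fin n) ℝ) (ε : ℝ) (h : s.Active)
    (α : Fin m → ℝ) :
    matInner ((1 / 2 : ℝ) • directSum (s.Cplus ε) (s.Cplus ε)
      - (1 / 2 : ℝ) • directSum (s.Cminus ε) (s.Cminus ε))
      (combo (fun i => directSum (M i) (M i)) α) = s.gain M ε α := by
  have hs : (s.Cplus ε - s.Cminus ε).IsHermitian := by
    rw [Cplus_eq, Cminus_eq]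
    exact ((grad_psd h.lower).isHermitian.smul (IsSelfAdjoint.all _)).sub
      ((grad_psd h.upper).isHermitian.smul (IsSelfAdjoint.all _))
  have hd := directSum_isHermitian hs hs
  rw [IsHermitian, conjTranspose_eq_transpose_of_trivial] at hd
  rw [half_directSum_sub, matInner, transpose_smul, hd, combo_directSum, Matrix.smul_mul,
    directSum_mul, trace_smul, trace_directSum, Cplus_eq, Cminus_eq, sub_mul, Matrix.smul_mul,
    Matrix.smul_mul, trace_sub, trace_smul, trace_smul, State.gain]
  simp only [smul_eq_mul]
  ring

variable {M : Fin m → Matrix (Fin n) (Fin n) ℝ} {ε S : ℝ}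
  {O : RandomisedOracle (Fin n ⊕ Fin n) (Fin m)}

theorem combo_psd (hM : ∀ i, (M i).PosSemidef) {α : Fin m → ℝ} (hα : ∀ i, 0 ≤ α i) :
    (combo M α).PosSemidef :=
  posSemidef_sum _ fun i _ => (hM i).smul (hα i)

theorem State.Active.query_spec (h : s.Active) (hM : ∀ i, (M i).PosSemidef)
    (hM1 : ∑ i, M i = 1) (hε1 : ε < 1 / 20) (hO : IsOneSidedOracle O S ε) :
    (∀ α ∈ (s.query O M ε).support, (nnz α : ℝ) ≤ lambdaMin s.B * (s.B⁻¹).trace ∧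
      (∀ i, 0 ≤ α i) ∧ (s.upperGap ^ 2 - combo M α).PosSemidef ∧
      (s.lowerGap ^ 2 - combo M α).PosSemidef) ∧
    S * lambdaMin s.B * ((1 - ε) * (1 - 2 * ε) * (grad s.lowerGap).trace
      - (1 + ε) * (1 + 2 * ε) * (grad s.upperGap).trace)
      ≤ ∑' α, (s.query O M ε α).toReal * s.gain M ε α := by
  have hε := hO.error_pos
  have a1 : ∀ i, (directSum (M i) (M i)).PosSemidef := fun i => directSum_psd (hM i) (hM i)
  have a2 : ∑ i, directSum (M i) (M i) = 1 := by rw [directSum_sum, hM1, directSum_one]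
  have hp : (s.Cplus ε).PosSemidef := (grad_psd h.lower).smul (by linarith)
  have hm : (s.Cminus ε).PosSemidef := (grad_psd h.upper).smul (by linarith)
  have a3 : ((1 / 2 : ℝ) • directSum (s.Cplus ε) (s.Cplus ε)).PosSemidef :=
    (directSum_psd hp hp).smul (by norm_num)
  have a4 : ((1 / 2 : ℝ) • directSum (s.Cminus ε) (s.Cminus ε)).PosSemidef :=
    (directSum_psd hm hm).smul (by norm_num)
  refine ⟨fun α hα => ⟨hO.sparse _ _ _ _ a1 a2 h.B_posDef h.one_sub_B a3 a4 α hα,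
    hO.nonneg _ _ _ _ a1 a2 h.B_posDef h.one_sub_B a3 a4 α hα, ?_⟩, ?_⟩
  · have := hO.bounded _ _ _ _ a1 a2 h.B_posDef h.one_sub_B a3 a4 α hα
    rw [combo_directSum, State.B, directSum_sub] at this
    exact psd_of_directSum this
  · have := hO.expectation _ _ _ _ a1 a2 h.B_posDef h.one_sub_B a3 a4
    simp only [matInner_eq_gain M ε h] at this
    refine le_trans (le_of_eq ?_) this
    rw [half_directSum_sub, ← smul_add, directSum_add]
    simp only [trace_smul, trace_directSum, trace_add, trace_sub, Cplus_eq, Cminus_eq, smul_eq_mul]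
    ring

/-- The effect of one answer of the oracle. -/
theorem State.Active.update_spec (h : s.Active) [NeZero n] (hM : ∀ i, (M i).PosSemidef)
    (hε : 0 < ε) (hε1 : ε < 1 / 20) (hS : 0 < S) (hS1 : S ≤ 1) {α : Fin m → ℝ}
    (hα : ∀ i, 0 ≤ α i) (hu : (s.upperGap ^ 2 - combo M α).PosSemidef)
    (hl : (s.lowerGap ^ 2 - combo M α).PosSemidef) :
    (s.update M ε S α).upperGap.PosDef ∧ (s.update M ε S α).lowerGap.PosDef ∧
    (s.update M ε S α).potential ≤ s.potential
      - (1 - 4 * ε) * s.deltaU ε S * (grad s.upperGap).trace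
      + (1 + 4 * ε) * s.deltaL ε S * (grad s.lowerGap).trace - ε * s.gain M ε α := by
  have hD := combo_psd hM hα
  have hlam := lambdaMin_pos h.B_posDef
  obtain ⟨hlu, hll⟩ := lambdaMin_smul_le h
  have hdu : s.deltaU ε S = ε * upperRate ε * S * lambdaMin s.B := rfl
  have hdl : s.deltaL ε S = ε * lowerRate ε * S * lambdaMin s.B := rfl
  have hP := upperRate_pos hε hε1
  have hQ := lowerRate_pos hε hε1
  have hPS : upperRate ε * S ≤ 3 / 2 := by nlinarith [upperRate_le hε hε1]
  have hQS : lowerRate ε * S ≤ 1 := by nlinarith [lowerRate_le hε hε1]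
  have h1 := pot_upper_step h.upper h.upperGap_le hD hu hε hε1
    (h := s.deltaU ε S) (by rw [hdu]; positivity)
    (smul_sub_smul_one_psd hlu (by positivity) (by
      rw [hdu]
      nlinarith [mul_pos hε hlam]))
  have h2 := pot_lower_step h.lower h.lowerGap_le hD hl hε hε1
    (h := s.deltaL ε S) (by rw [hdl]; positivity)
    (smul_sub_smul_one_psd hll hε.le (by
      rw [hdl]
      nlinarith [mul_pos hε hlam]))
  have e1 : (s.update M ε S α).upperGap
      = s.upperGap + s.deltaU ε S • 1 - ε • combo M α := by
    simp only [State.upperGap, State.update, add_smul]; abel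
  have e2 : (s.update M ε S α).lowerGap
      = s.lowerGap - s.deltaL ε S • 1 + ε • combo M α := by
    simp only [State.lowerGap, State.update, add_smul]; abel
  rw [State.potential, State.potential, State.gain, e1, e2]
  refine ⟨h1.1, h2.1, ?_⟩
  linarith [h1.2, h2.2]

theorem State.Active.mean_potential_le (h : s.Active) [NeZero n] (hM : ∀ i, (M i).PosSemidef)
    (hM1 : ∑ i, M i = 1) (hε1 : ε < 1 / 20) (hO : IsOneSidedOracle O S ε) :
    mean (s.query O M ε) (fun α => ENNReal.ofReal (s.update M ε S α).potential)
      ≤ ENNReal.ofReal s.potential := by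
  have hε := hO.error_pos
  obtain ⟨hq, hE⟩ := h.query_spec hM hM1 hε1 hO
  have hup := fun α hα => h.update_spec hM hε hε1 hO.speed_pos hO.speed_le_one
    (hq α hα).2.1 (hq α hα).2.2.1 (hq α hα).2.2.2
  -- Since `Δ` is below both squared gaps, the gain is bounded, as summability of its mean requires.
  -- The factor `2` covers `1 + 2ε`.
  refine mean_ofReal_le (X := s.gain M ε) _ (fun α hα => ?_) (fun α hα => (hup α hα).2.2)
    (b := (grad s.lowerGap * s.lowerGap ^ 2).trace + 2 * (grad s.upperGap * s.upperGap ^ 2).trace)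
    (fun α hα => ?_) ?_
  · exact add_nonneg (pot_nonneg (hup α hα).1) (pot_nonneg (hup α hα).2.1)
  · have hD := combo_psd hM (hq α hα).2.1
    have b1 := trace_mul_nonneg (grad_psd h.lower) hD
    have b2 := trace_mul_nonneg (grad_psd h.upper) hD
    have b3 := trace_mul_nonneg (grad_psd h.lower) (hq α hα).2.2.2
    have b4 := trace_mul_nonneg (grad_psd h.upper) (hq α hα).2.2.1
    rw [mul_sub, trace_sub] at b3 b4
    rw [State.gain, abs_le]
    constructor <;> nlinarith
  -- The denominators in the increments cancel the errors `1 ∓ 4ε`, leaving precisely `ε` times the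
  -- oracle's lower bound.
  · have e1 : (1 - 4 * ε) * s.deltaU ε S
        = ε * ((1 + 2 * ε) * (1 + ε)) * S * lambdaMin s.B := by
      have : 1 - 4 * ε ≠ 0 := by linarith
      rw [State.deltaU]; field_simp
    have e2 : (1 + 4 * ε) * s.deltaL ε S
        = ε * ((1 - 2 * ε) * (1 - ε)) * S * lambdaMin s.B := by
      have : 1 + 4 * ε ≠ 0 := by linarith
      rw [State.deltaL]; field_simp
    rw [e1, e2]
    have := mul_le_mul_of_nonneg_left hE hε.le
    linarith

end Step

/-! ### Deterministic consequences of a bounded potential. -/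

section Invariant

variable {n m : ℕ}

theorem inv_sq_le_two_exp {x : ℝ} (hx : 0 < x) : (x * x)⁻¹ ≤ 2 * Real.exp x⁻¹ := by
  have h := Real.quadratic_le_exp_of_nonneg (inv_pos.2 hx).le
  rw [mul_inv]
  nlinarith [inv_pos.2 hx]

theorem trace_inv_sq_le {d : Type} [Fintype d] [DecidableEq d] {W : Matrix d d ℝ}
    (hW : W.PosDef) : ((W ^ 2)⁻¹).trace ≤ 2 * pot W := by
  obtain ⟨U, w, hU, rfl, hw⟩ := exists_spec_pos hW
  rw [spec_pow_two hU, spec_inv hU (a := w * w) fun i => (mul_pos (hw i) (hw i)).ne',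
    trace_spec hU, pot_spec hU hw, Finset.mul_sum]
  exact Finset.sum_le_sum fun i _ => inv_sq_le_two_exp (hw i)

/-- No single summand `exp(1/w)` of the potential can exceed `T`, so each eigenvalue satisfies `w ≥
1 / log T`. -/
theorem sq_sub_inv_log_psd {d : Type} [Fintype d] [DecidableEq d] {W : Matrix d d ℝ} {T : ℝ}
    (hW : W.PosDef) (hT : pot W ≤ T) (hT1 : 1 < T) :
    (W ^ 2 - (Real.log T ^ 2)⁻¹ • 1).PosSemidef := by
  obtain ⟨U, w, hU, rfl, hw⟩ := exists_spec_pos hW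
  rw [pot_spec hU hw] at hT
  rw [spec_pow_two hU, ← spec_one hU, spec_smul, spec_sub, spec_psd_iff hU]
  intro i
  have h1 : Real.exp (w i)⁻¹ ≤ T :=
    (Finset.single_le_sum (f := fun i => Real.exp (w i)⁻¹)
      (fun i _ => (Real.exp_pos _).le) (Finset.mem_univ i)).trans hT
  have h2 : (w i)⁻¹ ≤ Real.log T := (Real.le_log_iff_exp_le (by linarith)).2 h1
  have h3 : (Real.log T)⁻¹ ≤ w i := inv_le_of_inv_le₀ (hw i) h2
  have h4 : 0 < (Real.log T)⁻¹ := inv_pos.2 (Real.log_pos hT1)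
  simp only [Pi.sub_apply, Pi.mul_apply, Pi.smul_apply, Pi.one_apply, smul_eq_mul, mul_one]
  rw [← inv_pow]
  nlinarith

theorem nnz_add_smul_le (a b : Fin m → ℝ) (c : ℝ) : nnz (a + c • b) ≤ nnz a + nnz b := by
  refine (Set.ncard_le_ncard ?_ (Set.toFinite _)).trans (Set.ncard_union_le _ _)
  intro i hi
  by_contra hc
  simp only [Set.mem_union, Function.mem_support, not_or, not_not] at hc
  exact hi (by simp [hc.1, hc.2])

/-- The deterministic bounds that hold as long as the potential has not exceeded `T`; `L` is the
sum of the smallest eigenvalues `λ_min(B)` over the iterations so far. -/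
structure Inv (M : Fin m → Matrix (Fin n) (Fin n) ℝ) (ε S T L : ℝ) (s : State n m) : Prop where
  upper : s.upperGap.PosDef
  lower : s.lowerGap.PosDef
  eq_combo : s.A = combo M s.coeff
  coeff_nonneg : ∀ i, 0 ≤ s.coeff i
  sum_nonneg : 0 ≤ L
  u_eq : s.u = 1 / 4 + ε * upperRate ε * S * L
  l_eq : s.l = -(1 / 4) + ε * lowerRate ε * S * L
  gap_le : s.u - s.l ≤ 2
  nnz_le : (nnz s.coeff : ℝ) ≤ 2 * T * L
  calls_le : (s.calls : ℝ) ≤ Real.log T ^ 2 * L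

variable {M : Fin m → Matrix (Fin n) (Fin n) ℝ} {ε S T L : ℝ} {s : State n m}
  {O : RandomisedOracle (Fin n ⊕ Fin n) (Fin m)}

theorem inv_init (M : Fin m → Matrix (Fin n) (Fin n) ℝ) (ε S T : ℝ) :
    Inv M ε S T 0 (init n m) where
  upper := by
    have : (init n m).upperGap = (1 / 4 : ℝ) • 1 := by simp [State.upperGap, init]
    rw [this]; exact PosDef.one.smul (by norm_num)
  lower := by
    have : (init n m).lowerGap = (1 / 4 : ℝ) • 1 := by simp [State.lowerGap, init]
    rw [this]; exact PosDef.one.smul (by norm_num)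
  eq_combo := by simp [init, combo]
  coeff_nonneg := by simp [init]
  sum_nonneg := le_rfl
  u_eq := by simp [init]
  l_eq := by simp [init]
  gap_le := by norm_num [init]
  nnz_le := by simp [init, nnz]
  calls_le := by simp [init]

theorem potential_init (n m : ℕ) : (init n m).potential = 2 * n * Real.exp 4 := by
  have h1 : (init n m).upperGap = spec 1 fun _ => 1 / 4 := by
    simp [State.upperGap, init, spec, smul_one_eq_diagonal]
  have h2 : (init n m).lowerGap = spec 1 fun _ => 1 / 4 := by
    simp [State.lowerGap, init, spec, smul_one_eq_diagonal]
  rw [State.potential, h1, h2, pot_spec (by simp) (by simp)]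
  simp
  ring

theorem combo_add_smul (M : Fin m → Matrix (Fin n) (Fin n) ℝ) (a b : Fin m → ℝ) (c : ℝ) :
    combo M (a + c • b) = combo M a + c • combo M b := by
  simp only [combo, Pi.add_apply, Pi.smul_apply, smul_eq_mul, add_smul, Finset.sum_add_distrib,
    Finset.smul_sum, smul_smul]

theorem Inv.active (h : Inv M ε S T L s) (hs : s.u - s.l < 1) : s.Active :=
  ⟨h.upper, h.lower, hs⟩

theorem Inv.update [NeZero n] (h : Inv M ε S T L s) (hs : s.u - s.l < 1)
    (hT : s.potential ≤ T) (hT1 : 1 < T) (hM : ∀ i, (M i).PosSemidef)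
    (hM1 : ∑ i, M i = 1) (hε1 : ε < 1 / 20) (hO : IsOneSidedOracle O S ε)
    {α : Fin m → ℝ} (hα : α ∈ (s.query O M ε).support) :
    Inv M ε S T (L + lambdaMin s.B) (s.update M ε S α) := by
  have hact := h.active hs
  have hε := hO.error_pos
  have hS := hO.speed_pos
  have hS1 := hO.speed_le_one
  obtain ⟨hsp, hα0, hu, hl⟩ := (hact.query_spec hM hM1 hε1 hO).1 α hα
  obtain ⟨hu', hl', -⟩ := hact.update_spec hM hε hε1 hS hS1 hα0 hu hl
  have hlam := lambdaMin_pos hact.B_posDef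
  have hlam1 := lambdaMin_le_one hact.B_posDef.isHermitian hact.one_sub_B
  have pu := pot_nonneg h.upper
  have pl := pot_nonneg h.lower
  have hue : (s.update M ε S α).u = s.u + ε * upperRate ε * S * lambdaMin s.B := rfl
  have hle : (s.update M ε S α).l = s.l + ε * lowerRate ε * S * lambdaMin s.B := rfl
  refine ⟨hu', hl', ?_, ?_, by linarith [h.sum_nonneg], ?_, ?_, ?_, ?_, ?_⟩
  · simp only [State.update, combo_add_smul, h.eq_combo]
  · intro i
    simp only [State.update, Pi.add_apply, Pi.smul_apply, smul_eq_mul]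
    exact add_nonneg (h.coeff_nonneg i) (mul_nonneg hε.le (hα0 i))
  · rw [hue, h.u_eq]; ring
  · rw [hle, h.l_eq]; ring
  -- The distance was below `1` and grows by at most `3ε/2`, so the bound `2` is generous.
  · have hSl : S * lambdaMin s.B ≤ 1 := by nlinarith
    have hP : upperRate ε - lowerRate ε ≤ 3 / 2 := by
      linarith [upperRate_le hε hε1, lowerRate_pos hε hε1]
    have hPQ : 0 ≤ upperRate ε - lowerRate ε :=
      (by positivity : (0 : ℝ) ≤ 14 * ε).trans (le_upperRate_sub hε hε1)
    have h1 : (upperRate ε - lowerRate ε) * (S * lambdaMin s.B) ≤ 3 / 2 * 1 :=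
      mul_le_mul hP hSl (by positivity) (by norm_num)
    rw [hue, hle]
    nlinarith [mul_nonneg hPQ (mul_nonneg hS.le hlam.le)]
  · have h1 : (nnz (s.update M ε S α).coeff : ℝ) ≤ nnz s.coeff + nnz α := by
      exact_mod_cast nnz_add_smul_le s.coeff α ε
    have h2 : (s.B⁻¹).trace ≤ 2 * T := by
      rw [State.B, directSum_inv (pow_two_posDef h.upper).isUnit (pow_two_posDef h.lower).isUnit,
        trace_directSum]
      rw [State.potential] at hT
      linarith [trace_inv_sq_le h.upper, trace_inv_sq_le h.lower]
    have h3 := mul_le_mul_of_nonneg_left h2 hlam.le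
    linarith [h.nnz_le]
  · have hlog : 0 < Real.log T ^ 2 := pow_pos (Real.log_pos hT1) 2
    have h1 : (Real.log T ^ 2)⁻¹ ≤ lambdaMin s.B := by
      apply le_lambdaMin hact.B_posDef.isHermitian
      rw [State.potential] at hT
      rw [State.B, ← directSum_one, directSum_smul, directSum_sub]
      exact directSum_psd (sq_sub_inv_log_psd h.upper (by linarith) hT1)
        (sq_sub_inv_log_psd h.lower (by linarith) hT1)
    have h2 : 1 ≤ Real.log T ^ 2 * lambdaMin s.B := by
      rwa [inv_le_iff_one_le_mul₀ hlog, mul_comm] at h1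
    have h3 : ((s.update M ε S α).calls : ℝ) = s.calls + 1 := by simp [State.update]
    rw [h3]
    linarith [h.calls_le]

/-- The distance starts at `1/2`, ends at most at `2`, and grows by at least `14ε²SL` in total;
finally `(3/2)/14 ≤ 1/9`. -/
theorem Inv.sum_le (h : Inv M ε S T L s) (hε : 0 < ε) (hε1 : ε < 1 / 20) (hS : 0 < S) :
    L ≤ 1 / 9 * (1 / (ε ^ 2 * S)) := by
  have h1 := h.gap_le
  rw [h.u_eq, h.l_eq] at h1
  have h2 := mul_le_mul_of_nonneg_right (le_upperRate_sub hε hε1)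
    (mul_nonneg (mul_nonneg hε.le hS.le) h.sum_nonneg)
  rw [mul_one_div, le_div_iff₀ (by positivity)]
  nlinarith

/-- The scaling `t = 2/(u+ℓ)` sends the midpoint of the barriers to `1`, so the relative error is
`(u-ℓ)/(u+ℓ)`. On exit `u-ℓ ≥ 1`, hence the initial `1/2` is at most the drift and `u-ℓ` is at most
twice the drift. -/
theorem Inv.isSpectralSparsifier (h : Inv M ε S T L s) (hM1 : ∑ i, M i = 1) (hε : 0 < ε)
    (hε1 : ε < 1 / 20) (hS : 0 < S) (hs : ¬ s.u - s.l < 1) :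
    ∃ t : ℝ, 0 < t ∧ IsSpectralSparsifier M (14 * ε) (t • s.coeff) := by
  have hP := upperRate_pos hε hε1
  have hQ := lowerRate_pos hε hε1
  have hL := h.sum_nonneg
  have hsum : s.u + s.l = ε * S * L * (upperRate ε + lowerRate ε) := by
    rw [h.u_eq, h.l_eq]; ring
  have hdiff : s.u - s.l = 1 / 2 + ε * S * L * (upperRate ε - lowerRate ε) := by
    rw [h.u_eq, h.l_eq]; ring
  have h1 := mul_le_mul_of_nonneg_left (upperRate_sub_le hε hε1)
    (mul_nonneg (mul_nonneg hε.le hS.le) hL)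
  have h2 : s.u - s.l ≤ 14 * ε * (s.u + s.l) := by
    rw [hsum]
    linarith
  have hpos : 0 < s.u + s.l := by
    by_contra hc
    push Not at hc hs
    nlinarith
  have hcombo : ∀ t : ℝ, combo M (t • s.coeff) = t • s.A := by
    intro t
    rw [h.eq_combo]
    simp only [combo, Pi.smul_apply, smul_eq_mul, Finset.smul_sum, smul_smul]
  have ht : 0 < 2 / (s.u + s.l) := by positivity
  have htu : 2 / (s.u + s.l) * s.u ≤ 1 + 14 * ε := by
    rw [div_mul_eq_mul_div, div_le_iff₀ hpos]; linarith
  have htl : 1 - 14 * ε ≤ 2 / (s.u + s.l) * s.l := by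
    rw [div_mul_eq_mul_div, le_div_iff₀ hpos]; linarith
  refine ⟨2 / (s.u + s.l), ht, by positivity, by linarith, ?_, ?_, ?_⟩
  · exact fun i => mul_nonneg ht.le (h.coeff_nonneg i)
  · have := (h.lower.posSemidef.smul ht.le).add
      ((PosSemidef.one (n := Fin n) (R := ℝ)).smul (sub_nonneg.2 htl))
    rw [hcombo, hM1]
    convert this using 1
    rw [State.lowerGap, smul_sub, smul_smul]
    module
  · have := (h.upper.posSemidef.smul ht.le).add
      ((PosSemidef.one (n := Fin n) (R := ℝ)).smul (sub_nonneg.2 htu))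
    rw [hcombo, hM1]
    convert this using 1
    rw [State.upperGap, smul_sub, smul_smul]
    module

end Invariant

/-! ### The supermartingale and termination. -/

section Run

variable {n m : ℕ} {M : Fin m → Matrix (Fin n) (Fin n) ℝ} {ε S T : ℝ}
  {O : RandomisedOracle (Fin n ⊕ Fin n) (Fin m)}

open Classical in
/-- The potential relative to `T`, capped at `1`, and `1` once the invariant is lost. -/
noncomputable def weight (M : Fin m → Matrix (Fin n) (Fin n) ℝ) (ε S T : ℝ) (s : State n m) :
    ENNReal :=
  if ∃ L, Inv M ε S T L s then min 1 (ENNReal.ofReal (s.potential / T)) else 1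

theorem weight_le_one (s : State n m) : weight M ε S T s ≤ 1 := by
  rw [weight]; split_ifs
  · exact min_le_left _ _
  · exact le_rfl

/-- At weight `1` there is nothing to prove, so no stopping time is needed. Below `1` the potential
is less than `T`, every possible answer preserves the invariant, and the mean bound for the
potential applies. -/
theorem mean_step_weight_le [NeZero n] (hT1 : 1 < T) (hM : ∀ i, (M i).PosSemidef)
    (hM1 : ∑ i, M i = 1) (hε1 : ε < 1 / 20) (hO : IsOneSidedOracle O S ε) (s : State n m) :
    mean (step O M ε S s) (weight M ε S T) ≤ weight M ε S T s := by
  rw [step]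
  split_ifs with hs
  swap
  · rw [mean_pure]
  have hT0 : 0 < T := by linarith
  by_cases hw : weight M ε S T s = 1
  · rw [hw]
    exact mean_const_le _ fun s' _ => weight_le_one s'
  have hinv : ∃ L, Inv M ε S T L s := by
    by_contra hc
    exact hw (if_neg hc)
  have hlt : ENNReal.ofReal (s.potential / T) < 1 := by
    by_contra hc
    exact hw (by rw [weight, if_pos hinv, min_eq_left (not_lt.1 hc)])
  have hwe : weight M ε S T s = ENNReal.ofReal (s.potential / T) := by
    rw [weight, if_pos hinv, min_eq_right hlt.le]
  have hpot : s.potential ≤ T := by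
    rw [ENNReal.ofReal_lt_one, div_lt_one hT0] at hlt
    exact hlt.le
  obtain ⟨L, hL⟩ := hinv
  rw [hwe, mean_map]
  have h1 : mean (s.query O M ε) (fun α => weight M ε S T (s.update M ε S α))
      ≤ mean (s.query O M ε) (fun α =>
        ENNReal.ofReal (s.update M ε S α).potential * ENNReal.ofReal T⁻¹) := by
    refine mean_mono _ fun α hα => ?_
    rw [weight, if_pos ⟨_, hL.update hs hpot hT1 hM hM1 hε1 hO hα⟩,
      ← ENNReal.ofReal_mul' (inv_pos.2 hT0).le, ← div_eq_mul_inv]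
    exact min_le_right _ _
  refine h1.trans ?_
  have h2 := (hL.active hs).mean_potential_le hM hM1 hε1 hO
  rw [div_eq_mul_inv, ENNReal.ofReal_mul' (inv_pos.2 hT0).le]
  refine le_trans (le_of_eq ?_) (mul_le_mul_left h2 _)
  simp only [mean, ← mul_assoc, ENNReal.tsum_mul_right]

theorem mean_run_weight_le [NeZero n] (hT1 : 1 < T) (hM : ∀ i, (M i).PosSemidef)
    (hM1 : ∑ i, M i = 1) (hε1 : ε < 1 / 20) (hO : IsOneSidedOracle O S ε) (k : ℕ) :
    mean (run O M ε S k) (weight M ε S T) ≤ weight M ε S T (init n m) := by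
  induction k with
  | zero => rw [run, mean_pure]
  | succ k ih =>
    rw [run, mean_bind]
    exact (mean_mono _ fun s _ => mean_step_weight_le hT1 hM hM1 hε1 hO s).trans ih

theorem calls_eq_of_mem_support_run (k : ℕ) :
    ∀ s ∈ (run O M ε S k).support, s.u - s.l < 1 → s.calls = k := by
  induction k with
  | zero =>
    intro s hs _
    rw [run, PMF.mem_support_pure_iff] at hs
    rw [hs]; rfl
  | succ k ih =>
    intro s hs hlt
    rw [run, PMF.mem_support_bind_iff] at hs
    obtain ⟨s', hs', hss⟩ := hs
    rw [step] at hss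
    split_ifs at hss with h
    · rw [PMF.mem_support_map_iff] at hss
      obtain ⟨α, -, rfl⟩ := hss
      simp only [State.update, ih s' hs' h]
    · rw [PMF.mem_support_pure_iff] at hss
      exact absurd (hss ▸ hlt) h

/-- If every state in the support that satisfies the invariant has halted with the property `E`,
the algorithm halts with the property `E` with probability at least `1/2`. -/
theorem half_le_haltProb [NeZero n] (hT : T = 4 * n * Real.exp 4) (hT1 : 1 < T)
    (hM : ∀ i, (M i).PosSemidef)
    (hM1 : ∑ i, M i = 1) (hε1 : ε < 1 / 20) (hO : IsOneSidedOracle O S ε) (k : ℕ)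
    {E : State n m → Prop}
    (hE : ∀ s ∈ (run O M ε S k).support, ∀ L, Inv M ε S T L s → ¬ s.u - s.l < 1 ∧ E s) :
    ENNReal.ofReal (1 / 2) ≤ haltProb O M ε S E := by
  refine le_trans ?_ (le_iSup (fun k => (run O M ε S k).toOuterMeasure
    {s | ¬ s.u - s.l < 1 ∧ E s}) k)
  -- `T` is twice the initial potential `2n exp 4`.
  have hw0 : weight M ε S T (init n m) ≤ ENNReal.ofReal (1 / 2) := by
    rw [weight, if_pos ⟨0, inv_init M ε S T⟩]
    refine (min_le_right _ _).trans (ENNReal.ofReal_le_ofReal (le_of_eq ?_))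
    have hn : (n : ℝ) ≠ 0 := by exact_mod_cast NeZero.ne n
    have := Real.exp_ne_zero 4
    rw [potential_init, hT]
    field_simp
    norm_num
  have h1 := (mean_run_weight_le hT1 hM hM1 hε1 hO k).trans hw0
  set G := {s : State n m | ¬ s.u - s.l < 1 ∧ E s} with hG
  -- Pointwise on the support, indicator plus weight is at least `1`: outside `G` the invariant
  -- fails, so the weight is `1`.
  have h2 : 1 ≤ (run O M ε S k).toOuterMeasure G + mean (run O M ε S k) (weight M ε S T) := by
    rw [PMF.toOuterMeasure_apply, mean, ← ENNReal.tsum_add, ← (run O M ε S k).tsum_coe]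
    refine ENNReal.tsum_le_tsum fun s => ?_
    by_cases hs : (run O M ε S k) s = 0
    · simp [hs]
    by_cases hsG : s ∈ G
    · rw [Set.indicator_of_mem hsG]; exact le_self_add
    · have : weight M ε S T s = 1 := if_neg fun ⟨L, hL⟩ =>
        hsG (hE s ((PMF.mem_support_iff _ _).2 hs) L hL)
      rw [this, mul_one]; exact le_add_self
  have h3 := h2.trans (add_le_add_right h1 _)
  have h4 : ENNReal.ofReal (1 / 2) + ENNReal.ofReal (1 / 2) = 1 := by
    rw [← ENNReal.ofReal_add (by norm_num) (by norm_num)]; norm_num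
  rw [← h4] at h3
  exact (ENNReal.add_le_add_iff_right ENNReal.ofReal_ne_top).1 h3

/-- The left side is `2 log 2 + log n + 4`, and `4 ≤ 6 log 2`. -/
theorem log_le_nine_mul_log {n : ℕ} (hn : 1 ≤ n) :
    Real.log (4 * n * Real.exp 4) ≤ 9 * Real.log (max n 2) := by
  have hn0 : (0 : ℝ) < n := by exact_mod_cast hn
  have h2 := Real.log_two_gt_d9
  have h3 : Real.log n ≤ Real.log (max n 2) := Real.log_le_log hn0 (le_max_left _ _)
  have h4 : Real.log 2 ≤ Real.log (max n 2) := Real.log_le_log (by norm_num) (le_max_right _ _)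
  have h5 : Real.log 4 = 2 * Real.log 2 := by
    rw [show (4 : ℝ) = 2 ^ 2 by norm_num, Real.log_pow]; norm_num
  rw [Real.log_mul (by positivity) (Real.exp_ne_zero 4), Real.log_mul (by norm_num) hn0.ne',
    Real.log_exp, h5]
  linarith

end Run

end Sparsify

/-! ### Assembly of the constants. -/

theorem lemma5 :
    ∃ p C₁ C₂ C₃ : ℝ, 0 < p ∧ 0 < C₁ ∧ 0 < C₂ ∧ 0 < C₃ ∧
      ∀ (n m : ℕ) (M : Fin m → Matrix (Fin n) (Fin n) ℝ) (ε S : ℝ)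
        (O : RandomisedOracle (Fin n ⊕ Fin n) (Fin m)),
        1 ≤ n → (∀ i, (M i).PosSemidef) → ∑ i, M i = 1 → 0 < ε → ε < 1 / 20 →
        IsOneSidedOracle O S ε →
        ENNReal.ofReal p ≤ Sparsify.haltProb O M ε S (fun s =>
          s.A = combo M s.coeff ∧
          (∃ t : ℝ, 0 < t ∧ IsSpectralSparsifier M (C₁ * ε) (t • s.coeff)) ∧
          (nnz s.coeff : ℝ) ≤ C₂ * (n / (ε ^ 2 * S)) ∧
          (s.calls : ℝ) ≤ C₃ * (Real.log (max n 2) ^ 2 / (ε ^ 2 * S))) := by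
  -- With `L ≤ 1/(9ε²S)` and `T = 4n exp 4`, sparsity costs `2T/9 = (8/9) n exp 4`, and calls cost
  -- `9² / 9 = 9` because `log T ≤ 9 log max(n,2)`.
  refine ⟨1 / 2, 14, Real.exp 4, 9, by norm_num, by norm_num, Real.exp_pos 4, by norm_num, ?_⟩
  intro n m M ε S O hn hM hM1 hε hε1 hO
  have : NeZero n := ⟨by omega⟩
  have hS := hO.speed_pos
  have hn1 : (1 : ℝ) ≤ n := by exact_mod_cast hn
  have hT1 : 1 < 4 * n * Real.exp 4 := by
    nlinarith [Real.one_le_exp (show (0 : ℝ) ≤ 4 by norm_num)]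
  -- A state still running after `k` passes has made `k` calls, so a `k` above the bound on calls
  -- forces halting.
  obtain ⟨k, hk⟩ := exists_nat_gt
    (Real.log (4 * n * Real.exp 4) ^ 2 * (1 / 9 * (1 / (ε ^ 2 * S))))
  refine Sparsify.half_le_haltProb rfl hT1 hM hM1 hε1 hO k fun s hs L hL => ?_
  have hsum := hL.sum_le hε hε1 hS
  have hcalls := hL.calls_le.trans (mul_le_mul_of_nonneg_left hsum (sq_nonneg _))
  have hhalt : ¬ s.u - s.l < 1 := by
    intro hlt
    rw [Sparsify.calls_eq_of_mem_support_run k s hs hlt] at hcalls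
    linarith
  have hpos : 0 ≤ 1 / (ε ^ 2 * S) := by positivity
  refine ⟨hhalt, hL.eq_combo, hL.isSpectralSparsifier hM1 hε hε1 hS hhalt, ?_, ?_⟩
  · refine hL.nnz_le.trans ((mul_le_mul_of_nonneg_left hsum (by positivity)).trans ?_)
    rw [div_eq_mul_one_div (n : ℝ)]
    have : 0 ≤ Real.exp 4 * n * (1 / (ε ^ 2 * S)) := by positivity
    linarith
  · refine hcalls.trans ?_
    have h1 := pow_le_pow_left₀ (Real.log_pos hT1).le (Sparsify.log_le_nine_mul_log hn) 2
    rw [div_eq_mul_one_div (Real.log _ ^ 2)]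
    nlinarith [mul_le_mul_of_nonneg_right h1 hpos]
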